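/- Let $n\ge 2$ and $1\le k\le n/2$. Consider type $C_n$ with weight lattice $\mathbb Z^n$, positive roots $e_i\pm e_j$ ($i<j$) and $2e_i$, Weyl group $W$ of signed permutations, Weyl vector $\rho=\sum_j(n-j+1)e_j$, and $\omega_m=e_1+\dots+e_m$ ($\omega_0=0$). Let $(C_\lambda)$ be symbols (linear indeterminates, or elements of any module over a characteristic-zero field containing invertible $q,t$) indexed by the dominant weights, extended to all weights by $C_\mu=(-1)^{l(\sigma)}C_\lambda$ if $\sigma(\mu+\rho)=\lambda+\rho$ with $\sigma\in W$, $\lambda$ dominant, and $C_\mu=0$ if $\mu+\rho$ is not regular. Put $C_{h,n}=C_{\omega_{2h}}$. For $N=n-j+1=(\rho,e_j)$ define $f_i^{j}(q,t)$ by $$(1-tz)(1-qtz)\frac{(t^2z)^{N}-1}{t^2z-1}=\sum_{i\ge0}t^{N}f_i^{j}(q,t)z^i,\qquad F_i^{j}=f_i^{j}(q,t)-q\,f_i^{j}(q^{-1},t^{-1}).$$ For $1\le r\le n/2$ the left-hand side of the quasi-minuscule recurrence for $\lambda=\omega_{2r}$ is $$Q_r=\sum_{(\mu,e_j)}\sum_{i\ge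 0}F_i^{j}\,C_{\mu-2ie_j},$$ where $(\mu,e_j)$ runs over the set of pairs $(w\omega_{2r},we_1)$, $w\in W$, with $2we_1$ a positive root. For $0\le h\le r$ let $\Lambda_h^{r,n}$ be the sum of $\varepsilon F_i^j$ over those pairs $(\mu,e_j)$ and those $i\ge0$ with $2i-1<(\rho,e_j)$ for which $C_{\mu-2ie_j}=\varepsilon C_{\omega_{2h}}$, $\varepsilon=\pm1$ (i.e. $\sigma(\mu-2ie_j+\rho)=\omega_{2h}+\rho$ with $(-1)^{l(\sigma)}=\varepsilon$), and let $R_r=\sum_{h=0}^r\Lambda_h^{r,n}C_{h,n}$ be the reduced recurrence. Define integers $A_h^{k,n}$ recursively by $A_h^{k,n}=0$ if $h>k$ or $h\le0$; otherwise $A_k^{k,n}=1$, $A_h^{k,n}=A_{h-1}^{k-1,n-2}$ if $1<h<k$, and $A_1^{k,n}=\sum_{i=2}^k(-1)^i\binom{n-i-1}{i-1}A_{i-1}^{k-1,n-2}$ if $k>1$. Then: (1) $Q_r=2R_r$ for all $1\le r\le k$, i.e. $R_r=0$ is the quasi-minuscule recurrence in reduced form; (2) $$\sum_{i=1}^kA_i^{k,n}R_i=\Lambda_k^{k,n}C_{k,n}+\Lambda_0^{1,n-2k+2}\left(C_{k-1,n}+\dots+C_{0,n}\right);$$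 (3) consequently, if the $C_\lambda$ satisfy the quasi-minuscule recurrences $Q_r=0$ for $1\le r\le k$, then $$\Lambda_k^{k,n}C_{k,n}+\Lambda_0^{1,n-2k+2}\left(C_{k-1,n}+\dots+C_{0,n}\right)=0.$$ -/

import Mathlib

namespace TypeC

open Finset

/-- Weights of type `C_n`, in the coordinates of the orthonormal basis `e_1, …, e_n`
(the index `i : Fin n` stands for `e_{i+1}`). The weight lattice is `ℤ^n`. -/
abbrev Weight (n : ℕ) : Type := Fin n → ℤ

/-- The basis vector `e_{i+1}`. -/
def e {n : ℕ} (i : Fin n) : Weight n := Pi.single i 1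

/-- The positive roots `e_i - e_j`, `e_i + e_j` (`i < j`) and `2 e_i`. -/
def posRoots (n : ℕ) : Finset (Weight n) :=
  ((univ : Finset (Fin n × Fin n)).filter (fun p => p.1 < p.2)).image (fun p => e p.1 - e p.2) ∪
  ((univ : Finset (Fin n × Fin n)).filter (fun p => p.1 < p.2)).image (fun p => e p.1 + e p.2) ∪
  (univ : Finset (Fin n)).image (fun i => (2 : ℤ) • e i)

/-- The Weyl vector `ρ = ∑_j (n - j + 1) e_j`. -/
def rho (n : ℕ) : Weight n := fun i => (n : ℤ) - (i : ℕ)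

/-- The fundamental weight `ω_m = e_1 + ⋯ + e_m` (and `ω_0 = 0`). -/
def omega (n m : ℕ) : Weight n := fun i => if (i : ℕ) < m then 1 else 0

/-- Dominant weights. -/
def Dominant {n : ℕ} (x : Weight n) : Prop := ∀ α ∈ posRoots n, 0 ≤ x ⬝ᵥ α

/-- Regular weights: those lying on no root hyperplane. -/
def Regular {n : ℕ} (x : Weight n) : Prop := ∀ α ∈ posRoots n, x ⬝ᵥ α ≠ 0

/-- The Weyl group of type `C_n`: all permutations and sign changes of the coordinates. -/
abbrev Weyl (n : ℕ) : Type := Equiv.Perm (Fin n) × (Fin n → ℤˣ)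

/-- The action of the Weyl group on weights: `e_i` is sent to `± e_{π(i)}`. -/
def act {n : ℕ} (w : Weyl n) (x : Weight n) : Weight n :=
  fun i => (w.2 i : ℤ) * x (w.1.symm i)

/-- The length of a Weyl group element: the number of positive roots that it makes negative. -/
def length {n : ℕ} (w : Weyl n) : ℕ :=
  ((posRoots n).filter (fun α => -(act w α) ∈ posRoots n)).card

open Classical in
/-- The extension of a family `C_λ` (`λ` dominant; the values of `C` elsewhere are ignored) to all
weights: `C_μ = (-1)^{l(σ)} C_λ` if `σ (μ + ρ) = λ + ρ` with `λ` dominant, and `C_μ = 0` if there is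
no such `σ` and `λ`, that is, if `μ + ρ` is not regular. -/
noncomputable def extend {n : ℕ} {M : Type*} [AddCommGroup M] (C : Weight n → M)
    (μ : Weight n) : M :=
  if h : ∃ p : Weyl n × Weight n, Dominant p.2 ∧ act p.1 (μ + rho n) = p.2 + rho n then
    (-1 : ℤ) ^ length h.choose.1 • C h.choose.2
  else 0

/-- The polynomial `(1 - t z)(1 - q t z)((t² z)^N - 1)/(t² z - 1)` in the variable `z`. -/
noncomputable def genPoly {K : Type*} [Field K] (N : ℕ) (q t : K) : Polynomial K :=
  (1 - Polynomial.C t * Polynomial.X) * (1 - Polynomial.C (q * t) * Polynomial.X) *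
    ∑ m ∈ range N, (Polynomial.C (t ^ 2) * Polynomial.X) ^ m

/-- The functions `f_i^β(q, t)` with `N = (ρ, β^∨)`, given by
`(1 - t z)(1 - q t z)((t² z)^N - 1)/(t² z - 1) = ∑_i t^N f_i^β(q, t) z^i`. -/
noncomputable def f {K : Type*} [Field K] (N i : ℕ) (q t : K) : K :=
  (t ^ N)⁻¹ * (genPoly N q t).coeff i

/-- `F_i = f_i(q, t) - q^d f_i(q⁻¹, t⁻¹)`. -/
noncomputable def F {K : Type*} [Field K] (d : ℤ) (N i : ℕ) (q t : K) : K :=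
  f N i q t - q ^ d * f N i q⁻¹ t⁻¹

/-- The set of pairs `(w λ, w e_1)`, `w ∈ W`, such that the root `w θ = 2 w e_1` is positive.
The second entry `b` is one of the `e_j`; it is the coroot of the long root `β = 2 b = w θ`. -/
def pairs {n : ℕ} (lam : Weight n) : Finset (Weight n × Weight n) :=
  ((univ : Finset (Weyl n)).image (fun w => (act w lam, act w (omega n 1)))).filter
    (fun p => (2 : ℤ) • p.2 ∈ posRoots n)

/-- `(ρ, β^∨)` for the root `β = 2 b`, `b = e_j`. -/
def ht {n : ℕ} (b : Weight n) : ℕ := (rho n ⬝ᵥ b).toNat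

/-- The left-hand side
`∑_{(μ, β)} ∑_{i ≥ 0} [f_i^β(q, t) - q^{(λ, e_1)} f_i^β(q⁻¹, t⁻¹)] C_{μ - i β}`
of the quasi-minuscule recurrence for `λ`, where `β = 2 b` and `e_1 = θ^∨`.
The terms with `i ≥ (ρ, β^∨) + 2` vanish. -/
noncomputable def qmRecurrence {n : ℕ} {K M : Type*} [Field K] [AddCommGroup M] [Module K M]
    (lam : Weight n) (q t : K) (C : Weight n → M) : M :=
  ∑ p ∈ pairs lam, ∑ i ∈ range (ht p.2 + 2),
    F (lam ⬝ᵥ omega n 1) (ht p.2) i q t • extend C (p.1 - (i : ℤ) • ((2 : ℤ) • p.2))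

/-- The coefficient `Λ_h^{k,n}` of `C_{ω_{2h}}` in the reduced recurrence for `ω_{2k}`: the sum of
`ε F_i^j` over the pairs `(μ, e_j)` and the indices `i` with `2 i - 1 < (ρ, e_j)` for which
`μ - 2 i e_j` is conjugated to `ω_{2h}`, with sign `ε`, i.e. `C_{μ - 2 i e_j} = ε C_{ω_{2h}}`.
(The indices with `2 i - 1 > (ρ, e_j)` contribute the same amount to the whole recurrence, those
with `2 i - 1 = (ρ, e_j)` contribute zero.) -/
noncomputable def Lam {K : Type*} [Field K] (n k h : ℕ) (q t : K) : K :=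
  ∑ p ∈ pairs (omega n (2 * k)), ∑ i ∈ (range (ht p.2 + 2)).filter (fun i => 2 * i < ht p.2 + 1),
    F (omega n (2 * k) ⬝ᵥ omega n 1) (ht p.2) i q t *
      extend (fun μ => if μ = omega n (2 * h) then (1 : K) else 0)
        (p.1 - (i : ℤ) • ((2 : ℤ) • p.2))

/-- The reduced recurrence `R_k = ∑_{h=0}^k Λ_h^{k,n} C_{ω_{2h}}`, a linear form in the `C`. -/
noncomputable def R {K M : Type*} [Field K] [AddCommGroup M] [Module K M]
    (n k : ℕ) (q t : K) (C : Weight n → M) : M :=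
  ∑ h ∈ range (k + 1), Lam n k h q t • C (omega n (2 * h))

/-- The integers `A_h^{k,n}`, for `k` and `n` as the first two arguments: `0` if `h > k` or `h ≤ 0`,
`1` if `h = k`, `A_{h-1}^{k-1,n-2}` if `1 < h < k`, and
`∑_{i=2}^k (-1)^i binom(n-i-1, i-1) A_{i-1}^{k-1,n-2}` if `h = 1 < k`. -/
def A : ℕ → ℕ → ℕ → ℤ
  | 0, _, _ => 0
  | k + 1, n, h =>
    if h = 0 ∨ k + 1 < h then 0
    else if h = k + 1 then 1
    else if 1 < h then A k (n - 2) (h - 1)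
    else ∑ i ∈ Icc 2 (k + 1), (-1) ^ i * ((n - i - 1).choose (i - 1) : ℤ) * A k (n - 2) (i - 1)

/-! Helper facts: the definitions above are well formed. -/

theorem dot_e {n : ℕ} (x : Weight n) (i : Fin n) : x ⬝ᵥ e i = x i := by
  simp [e]

theorem mem_posRoots {n : ℕ} (α : Weight n) : α ∈ posRoots n ↔
    (∃ i j : Fin n, i < j ∧ α = e i - e j) ∨ (∃ i j : Fin n, i < j ∧ α = e i + e j) ∨
      ∃ i : Fin n, α = (2 : ℤ) • e i := by
  simp only [posRoots, mem_union, mem_image, mem_filter, mem_univ, true_and, Prod.exists, or_assoc,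
    eq_comm (a := α)]

theorem Dominant.strictAnti {n : ℕ} {x : Weight n} (hx : Dominant x) :
    StrictAnti (x + rho n) := by
  intro i j hij
  have h := hx (e i - e j) ((mem_posRoots _).2 (Or.inl ⟨i, j, hij, rfl⟩))
  rw [dotProduct_sub, dot_e, dot_e] at h
  have : (i : ℕ) < j := hij
  simp only [Pi.add_apply, rho]
  omega

theorem Dominant.pos {n : ℕ} {x : Weight n} (hx : Dominant x) (i : Fin n) :
    0 < (x + rho n) i := by
  have h := hx ((2 : ℤ) • e i) ((mem_posRoots _).2 (Or.inr (Or.inr ⟨i, rfl⟩)))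
  rw [dotProduct_smul, dot_e, smul_eq_mul] at h
  have := i.2
  simp only [Pi.add_apply, rho]
  omega

/-- The dominant weight conjugated to a given weight, and the conjugating element, are unique. -/
theorem conj_unique {n : ℕ} {x : Weight n} {σ τ : Weyl n} {a b : Weight n}
    (ha : Dominant a) (hb : Dominant b) (h₁ : act σ x = a + rho n) (h₂ : act τ x = b + rho n) :
    σ = τ ∧ a = b := by
  obtain ⟨π, ε⟩ := σ
  obtain ⟨π', ε'⟩ := τ
  have hu : ∀ u : ℤˣ, (u : ℤ) = 1 ∨ (u : ℤ) = -1 := fun u => by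
    rcases Int.units_eq_one_or u with h | h <;> simp [h]
  have key : ∀ i, (a + rho n) (π i) = |x i| := fun i => by
    have hp := ha.pos (π i)
    rw [← h₁] at hp ⊢
    simp only [act, Equiv.symm_apply_apply] at hp ⊢
    rw [← abs_of_pos hp, abs_mul]
    rcases hu (ε (π i)) with h | h <;> simp [h]
  have key' : ∀ i, (b + rho n) (π' i) = |x i| := fun i => by
    have hp := hb.pos (π' i)
    rw [← h₂] at hp ⊢
    simp only [act, Equiv.symm_apply_apply] at hp ⊢
    rw [← abs_of_pos hp, abs_mul]
    rcases hu (ε' (π' i)) with h | h <;> simp [h]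
  have hmono : StrictMono (fun i => π' (π.symm i)) := by
    intro i j hij
    have h := ha.strictAnti hij
    have e1 := key (π.symm i)
    have e2 := key (π.symm j)
    rw [Equiv.apply_symm_apply, ← key'] at e1 e2
    rw [e1, e2] at h
    exact hb.strictAnti.lt_iff_gt.1 h
  have hid : ∀ i, π' (π.symm i) = i := by
    intro i
    have hs : Function.Surjective (fun i => π' (π.symm i)) :=
      π'.surjective.comp π.symm.surjective
    have : StrictMono.orderIsoOfSurjective _ hmono hs = OrderIso.refl (Fin n) :=
      Subsingleton.elim _ _
    exact congrArg (fun g : Fin n ≃o Fin n => g i) this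
  have hπ : π = π' := Equiv.ext fun i => by simpa using (hid (π i)).symm
  subst hπ
  have hab : a = b := by
    funext i
    have h := (key (π.symm i)).trans (key' (π.symm i)).symm
    simpa using h
  subst hab
  refine ⟨Prod.ext rfl (funext fun i => ?_), rfl⟩
  have h := congrFun (h₁.trans h₂.symm) i
  have hp := ha.pos i
  rw [← h₁] at hp
  simp only [act] at h hp
  exact Units.ext (mul_right_cancel₀ (right_ne_zero_of_mul hp.ne') h)

theorem extend_of_conj {n : ℕ} {M : Type*} [AddCommGroup M] (C : Weight n → M)
    {μ lam : Weight n} {σ : Weyl n} (hl : Dominant lam) (h : act σ (μ + rho n) = lam + rho n) :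
    extend C μ = (-1 : ℤ) ^ length σ • C lam := by
  have hex : ∃ p : Weyl n × Weight n, Dominant p.2 ∧ act p.1 (μ + rho n) = p.2 + rho n :=
    ⟨(σ, lam), hl, h⟩
  obtain ⟨h1, h2⟩ := conj_unique hex.choose_spec.1 hl hex.choose_spec.2 h
  rw [extend, dif_pos hex, h1, h2]

theorem extend_of_not_regular {n : ℕ} {M : Type*} [AddCommGroup M] (C : Weight n → M)
    {μ : Weight n} (h : ¬ Regular (μ + rho n)) : extend C μ = 0 := by
  rw [extend, dif_neg]
  rintro ⟨⟨⟨π, ε⟩, lam⟩, hl, hc⟩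
  apply h
  have hu : ∀ u : ℤˣ, (u : ℤ) = 1 ∨ (u : ℤ) = -1 := fun u => by
    rcases Int.units_eq_one_or u with h | h <;> simp [h]
  have key : ∀ i, (lam + rho n) (π i) = (ε (π i) : ℤ) * (μ + rho n) i := fun i => by
    rw [← hc]; simp [act]
  have hne : ∀ i j : Fin n, i < j → (lam + rho n) (π i) ≠ (lam + rho n) (π j) := fun i j hij h =>
    hij.ne (π.injective (hl.strictAnti.injective h))
  have hpos : ∀ i, 0 < (lam + rho n) (π i) := fun i => hl.pos _
  intro α hα
  rcases (mem_posRoots α).1 hα with ⟨i, j, hij, rfl⟩ | ⟨i, j, hij, rfl⟩ | ⟨i, rfl⟩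
  · rw [dotProduct_sub, dot_e, dot_e]
    have a1 := hne i j hij
    have a2 := hpos i
    have a3 := hpos j
    rw [key] at a1 a2 a3
    rw [key] at a1
    rcases hu (ε (π i)) with h | h <;> rcases hu (ε (π j)) with h' | h' <;> rw [h] at a1 a2 <;>
      rw [h'] at a1 a3 <;> omega
  · rw [dotProduct_add, dot_e, dot_e]
    have a1 := hne i j hij
    have a2 := hpos i
    have a3 := hpos j
    rw [key] at a1 a2 a3
    rw [key] at a1
    rcases hu (ε (π i)) with h | h <;> rcases hu (ε (π j)) with h' | h' <;> rw [h] at a1 a2 <;>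
      rw [h'] at a1 a3 <;> omega
  · rw [dotProduct_smul, dot_e, smul_eq_mul]
    have a2 := hpos i
    rw [key] at a2
    have := right_ne_zero_of_mul a2.ne'
    omega

theorem genPoly_mul {K : Type*} [Field K] (N : ℕ) (q t : K) :
    genPoly N q t * (Polynomial.C (t ^ 2) * Polynomial.X - 1) =
      (1 - Polynomial.C t * Polynomial.X) * (1 - Polynomial.C (q * t) * Polynomial.X) *
        ((Polynomial.C (t ^ 2) * Polynomial.X) ^ N - 1) := by
  rw [genPoly, mul_assoc, geom_sum_mul]

theorem f_eq_zero {K : Type*} [Field K] (N i : ℕ) (q t : K) (h : N + 2 ≤ i) : f N i q t = 0 := by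
  rcases Nat.eq_zero_or_pos N with rfl | hN
  · simp [f, genPoly]
  rw [f, Polynomial.coeff_eq_zero_of_natDegree_lt, mul_zero]
  have h1 : ∀ c : K, (1 - Polynomial.C c * Polynomial.X).natDegree ≤ 1 := fun c => by
    compute_degree
  have h2 : (∑ m ∈ range N, (Polynomial.C (t ^ 2) * Polynomial.X) ^ m).natDegree ≤ N - 1 := by
    refine Polynomial.natDegree_sum_le_of_forall_le _ _ fun m hm => ?_
    have := mem_range.1 hm
    refine (Polynomial.natDegree_pow_le_of_le m (m := 1) ?_).trans ?_
    · compute_degree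
    omega
  have h3 := Polynomial.natDegree_mul_le_of_le
    (Polynomial.natDegree_mul_le_of_le (h1 t) (h1 (q * t))) h2
  rw [genPoly]
  omega

end TypeC

namespace TypeC

open Finset

/-! Part (1) is a symmetry. The polynomial behind `f` is self-reciprocal up to inverting q and t, so
F_{N+1-i} = -F_i, while the shifted reflection in 2e_j exchanges the weights for i and N+1-i at the
cost of a sign. The two halves of the sum over i therefore agree (`qmRecurrence_omega`).

For (2), the Λ are encoded in polynomials. When all shifted coordinates are nonnegative, the
extension of an indicator is a 0-1 determinant (`extend_indicator`). Multilinearity sums these over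
all sign vectors, with X marking nonzero coordinates, and Λ_h^{r,n} becomes the coefficient of
X^{2r} in `genLam q t n (2 * h)` (`Lam_eq_coeff`). The first 2h columns split off, each giving a
factor X and one value of `leadF` (`genLam_add`); what remains is tridiagonal, with 1 on the
diagonal and X beside it. Its determinants have coefficients (-1)^s binom(m-s, s), and its cofactors
are, up to powers of -X, products of two such determinants. As the F_i with i ≥ 2 are differences of
`primF`, summation by parts gives a recurrence in n (`genLam_zero_add_two`). With c(s,m) = Λ_0^{s,m}
and c(0,m) = 0 this reads c(s+1,m+2) = c(s,m) + (-1)^s binom(m-s, s) c(1,m+2), Λ_h^{s+h,m+2h} =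
c(s,m) + K (-1)^s binom(m-s, s), with K independent of s.

The A_i are built to annihilate the signed binomials (`sum_A_mul_choose`). Hence in Σ A_i R_i every
coefficient with h < k collapses to c(1,n-2k+2) (`sum_A_mul_Lam`), and for h = k only i = k
contributes. Part (3) follows on cancelling the factor 2. -/

/-! ### The coefficients F_i: reflection and closed forms. -/

/-- The coefficients of `((t² z)^N - 1)/(t² z - 1)`, indexed by the integers. -/
def geomCoeff {K : Type*} [Field K] (N : ℕ) (t : K) (i : ℤ) : K :=
  if 0 ≤ i ∧ i < N then t ^ (2 * i) else 0

theorem coeff_geom {K : Type*} [Field K] (N i : ℕ) (t : K) :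
    (∑ m ∈ range N, (Polynomial.C (t ^ 2) * Polynomial.X) ^ m).coeff i = geomCoeff N t i := by
  simp only [Polynomial.finsetSum_coeff, mul_pow, ← Polynomial.C_pow, Polynomial.coeff_C_mul,
    Polynomial.coeff_X_pow, mul_ite, mul_one, mul_zero, sum_ite_eq, mem_range, geomCoeff,
    Nat.cast_nonneg, true_and, Nat.cast_lt]
  refine if_congr Iff.rfl ?_ rfl
  rw [← pow_mul]
  norm_cast

theorem coeff_genPoly {K : Type*} [Field K] (N i : ℕ) (q t : K) :
    (genPoly N q t).coeff i = geomCoeff N t i - t * (1 + q) * geomCoeff N t (i - 1) +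
      q * t ^ 2 * geomCoeff N t (i - 2) := by
  have h : genPoly N q t = (∑ m ∈ range N, (Polynomial.C (t ^ 2) * Polynomial.X) ^ m) -
      Polynomial.C (t * (1 + q)) *
        ((∑ m ∈ range N, (Polynomial.C (t ^ 2) * Polynomial.X) ^ m) * Polynomial.X) +
      Polynomial.C (q * t ^ 2) *
        ((∑ m ∈ range N, (Polynomial.C (t ^ 2) * Polynomial.X) ^ m) * Polynomial.X ^ 2) := by
    rw [genPoly]
    simp only [map_mul, map_add, map_one, map_pow]
    ring
  rw [h, Polynomial.coeff_add, Polynomial.coeff_sub, Polynomial.coeff_C_mul,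
    Polynomial.coeff_C_mul, Polynomial.coeff_mul_X_pow', coeff_geom]
  have hneg : ∀ z : ℤ, z < 0 → geomCoeff N t z = 0 := fun z hz => by
    rw [geomCoeff, if_neg (by omega)]
  congr 2
  · rcases i with _ | i
    · simp [hneg]
    · rw [Polynomial.coeff_mul_X, coeff_geom]
      push_cast
      rw [add_sub_cancel_right]
  · split_ifs with h2
    · rw [coeff_geom]
      push_cast [h2]
      rfl
    · rw [hneg _ (by omega)]

theorem geomCoeff_reflect {K : Type*} [Field K] (N : ℕ) {t : K} (ht : t ≠ 0) (i : ℤ) :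
    geomCoeff N t (N - 1 - i) = t ^ (2 * (N : ℤ) - 2) * geomCoeff N t⁻¹ i := by
  unfold geomCoeff
  by_cases h : 0 ≤ i ∧ i < N
  · rw [if_pos h, if_pos (by omega), inv_zpow', ← zpow_add₀ ht]
    congr 1
    ring
  · rw [if_neg h, if_neg (by omega), mul_zero]

/-- Reversing a polynomial of formal degree N + 1: the two linear factors reverse to q t² times
themselves at inverted parameters, the geometric sum to t^(2N-2) times itself. The total q t^(2N)
turns the prefactor t^(-N) into q t^N. -/
theorem f_reflect {K : Type*} [Field K] (N i : ℕ) {q t : K} (hq : q ≠ 0) (ht : t ≠ 0)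
    (hi : i ≤ N + 1) : f N (N + 1 - i) q t = q * f N i q⁻¹ t⁻¹ := by
  have h0 : ((N + 1 - i : ℕ) : ℤ) = N - 1 - (i - 2) := by push_cast [hi]; ring
  have h1 : ((N + 1 - i : ℕ) : ℤ) - 1 = N - 1 - (i - 1) := by push_cast [hi]; ring
  have h2 : ((N + 1 - i : ℕ) : ℤ) - 2 = N - 1 - i := by push_cast [hi]; ring
  rw [f, f, coeff_genPoly, coeff_genPoly, h1, h2, h0, geomCoeff_reflect N ht,
    geomCoeff_reflect N ht, geomCoeff_reflect N ht, zpow_sub₀ ht, two_mul, zpow_add₀ ht]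
  simp only [zpow_natCast, zpow_ofNat, inv_pow, inv_inv]
  field_simp
  ring

theorem F_reflect {K : Type*} [Field K] (N i : ℕ) {q t : K} (hq : q ≠ 0) (ht : t ≠ 0)
    (hi : i ≤ N + 1) : F 1 N (N + 1 - i) q t = -F 1 N i q t := by
  have h := f_reflect N (N + 1 - i) hq ht (by omega)
  rw [Nat.sub_sub_self hi] at h
  rw [F, F, f_reflect N i hq ht hi, h, zpow_one]
  ring

/-- The value of `F_0` at height `N`. -/
def leadF {K : Type*} [Field K] (q t : K) (N : ℕ) : K :=
  t ^ (-(N : ℤ)) - q * t ^ (N : ℤ)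

/-- A primitive for the values of `F_i`, `i ≥ 2`, as functions of `(ρ, β^∨) + 1 - 2 i`. -/
def primF {K : Type*} [Field K] (q t : K) (x : ℕ) : K :=
  t ^ (1 - (x : ℤ)) - q * t ^ ((x : ℤ) - 1) + t ^ (x : ℤ) - q * t ^ (-(x : ℤ))

theorem F_zero {K : Type*} [Field K] (q t : K) {N : ℕ} (hN : 1 ≤ N) :
    F 1 N 0 q t = leadF q t N := by
  rw [F, f, f, coeff_genPoly, coeff_genPoly]
  have h : ∀ s : K, geomCoeff N s ((0 : ℕ) : ℤ) = 1 := fun s => by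
    rw [geomCoeff, if_pos (by omega)]; simp
  have h1 : ∀ s : K, geomCoeff N s ((0 : ℕ) - 1 : ℤ) = 0 := fun s => by
    rw [geomCoeff, if_neg (by omega)]
  have h2 : ∀ s : K, geomCoeff N s ((0 : ℕ) - 2 : ℤ) = 0 := fun s => by
    rw [geomCoeff, if_neg (by omega)]
  rw [h, h1, h2, h, h1, h2, leadF, zpow_neg]
  simp

theorem F_one {K : Type*} [Field K] {q t : K} (hq : q ≠ 0) (ht : t ≠ 0) {N : ℕ} (hN : 1 ≤ N) :
    F 1 (N + 1) 1 q t = primF q t N - leadF q t N := by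
  rw [F, f, f, coeff_genPoly, coeff_genPoly]
  have h : ∀ s : K, geomCoeff (N + 1) s ((1 : ℕ) : ℤ) = s ^ 2 := fun s => by
    rw [geomCoeff, if_pos (by omega)]; norm_cast
  have h1 : ∀ s : K, geomCoeff (N + 1) s ((1 : ℕ) - 1 : ℤ) = 1 := fun s => by
    rw [geomCoeff, if_pos (by omega)]; simp
  have h2 : ∀ s : K, geomCoeff (N + 1) s ((1 : ℕ) - 2 : ℤ) = 0 := fun s => by
    rw [geomCoeff, if_neg (by omega)]
  rw [h, h1, h2, h, h1, h2, leadF, primF, zpow_sub₀ ht, zpow_sub₀ ht, zpow_neg]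
  simp only [zpow_natCast, zpow_one, inv_pow, inv_inv]
  field_simp
  ring

/-- Here all three geometric coefficients are nonzero, and the result depends on the height and the
index only through x. Being a difference, it can be summed by parts. -/
theorem F_add_two {K : Type*} [Field K] {q t : K} (hq : q ≠ 0) (ht : t ≠ 0) {N i x : ℕ}
    (hx : 1 ≤ x) (h : N = x + 2 * i + 3) : F 1 N (i + 2) q t = primF q t x - primF q t (x + 1) := by
  subst h
  rw [F, f, f, coeff_genPoly, coeff_genPoly]
  have h : ∀ s : K, geomCoeff (x + 2 * i + 3) s ((i + 2 : ℕ) : ℤ) = s ^ (2 * (i + 2)) := fun s => by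
    rw [geomCoeff, if_pos (by omega)]; norm_cast
  have h1 : ∀ s : K, geomCoeff (x + 2 * i + 3) s ((i + 2 : ℕ) - 1 : ℤ) = s ^ (2 * (i + 1)) := by
    intro s
    rw [geomCoeff, if_pos (by omega), ← zpow_natCast]; push_cast; congr 1; ring
  have h2 : ∀ s : K, geomCoeff (x + 2 * i + 3) s ((i + 2 : ℕ) - 2 : ℤ) = s ^ (2 * i) := by
    intro s
    rw [geomCoeff, if_pos (by omega), ← zpow_natCast]; push_cast; congr 1; ring
  rw [h, h1, h2, h, h1, h2, primF, primF]
  push_cast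
  rw [add_sub_cancel_right, show (1 : ℤ) - (x + 1) = -x by ring, zpow_sub₀ ht, zpow_sub₀ ht,
    neg_add, zpow_add₀ ht (-(x : ℤ)), zpow_add₀ ht, zpow_neg, zpow_neg]
  simp only [zpow_natCast, zpow_one, inv_pow, inv_inv]
  field_simp
  ring

/-! ### Signs of Weyl group elements and antisymmetry of the extension. -/

theorem units_eq (u : ℤˣ) : (u : ℤ) = 1 ∨ (u : ℤ) = -1 := by
  rcases Int.units_eq_one_or u with h | h <;> simp [h]

theorem act_e {n : ℕ} (w : Weyl n) (i : Fin n) : act w (e i) = (w.2 (w.1 i) : ℤ) • e (w.1 i) := by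
  funext j
  simp only [act, e, Pi.smul_apply, smul_eq_mul, Pi.single_apply, Equiv.symm_apply_eq]
  split_ifs with h
  · rw [h]
  · simp

theorem act_add {n : ℕ} (w : Weyl n) (x y : Weight n) : act w (x + y) = act w x + act w y := by
  funext j
  simp only [act, Pi.add_apply, mul_add]

theorem act_sub {n : ℕ} (w : Weyl n) (x y : Weight n) : act w (x - y) = act w x - act w y := by
  funext j
  simp only [act, Pi.sub_apply, mul_sub]

theorem act_smul {n : ℕ} (w : Weyl n) (c : ℤ) (x : Weight n) : act w (c • x) = c • act w x := by
  funext j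
  simp only [act, Pi.smul_apply, smul_eq_mul, mul_left_comm]

/-- Pairing with ρ is the test by which a signed combination of basis vectors is recognised as not
positive. -/
theorem rho_dot_pos {n : ℕ} {α : Weight n} (h : α ∈ posRoots n) : 0 < rho n ⬝ᵥ α := by
  rcases (mem_posRoots α).1 h with ⟨i, j, hij, rfl⟩ | ⟨i, j, hij, rfl⟩ | ⟨i, rfl⟩
  · rw [dotProduct_sub, dot_e, dot_e, rho, rho]
    have : (i : ℕ) < j := hij
    omega
  · rw [dotProduct_add, dot_e, dot_e, rho, rho]
    omega
  · rw [dotProduct_smul, dot_e, rho, smul_eq_mul]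
    omega

theorem smul_add_smul_mem_posRoots {n : ℕ} {a b : Fin n} (hab : a < b) (u v : ℤˣ) :
    (u : ℤ) • e a + (v : ℤ) • e b ∈ posRoots n ↔ (u : ℤ) = 1 := by
  have hab' : (a : ℕ) < b := hab
  constructor
  · intro h
    have h1 := rho_dot_pos h
    rw [dotProduct_add, dotProduct_smul, dotProduct_smul, dot_e, dot_e, rho, rho, smul_eq_mul,
      smul_eq_mul] at h1
    rcases units_eq u with hu | hu
    · exact hu
    · rcases units_eq v with hv | hv <;> rw [hu, hv] at h1 <;> omega
  · intro hu
    rw [hu, one_smul, mem_posRoots]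
    rcases units_eq v with hv | hv <;> rw [hv]
    · exact Or.inr (Or.inl ⟨a, b, hab, by rw [one_smul]⟩)
    · exact Or.inl ⟨a, b, hab, by rw [neg_one_smul, sub_eq_add_neg]⟩

theorem smul_e_mem_posRoots {n : ℕ} {a : Fin n} (u : ℤˣ) :
    (2 : ℤ) • (u : ℤ) • e a ∈ posRoots n ↔ (u : ℤ) = 1 := by
  constructor
  · intro h
    have h1 := rho_dot_pos h
    rw [dotProduct_smul, dotProduct_smul, dot_e, rho, smul_eq_mul, smul_eq_mul] at h1
    rcases units_eq u with hu | hu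
    · exact hu
    · rw [hu] at h1; omega
  · intro hu
    rw [hu, one_smul, mem_posRoots]
    exact Or.inr (Or.inr ⟨a, rfl⟩)

/-- The sign contributed by a positive root to the sign of a Weyl group element. -/
def rootSign {n : ℕ} (w : Weyl n) (α : Weight n) : ℤ :=
  if -(act w α) ∈ posRoots n then -1 else 1

theorem rootSign_two_smul {n : ℕ} (w : Weyl n) (i : Fin n) :
    rootSign w ((2 : ℤ) • e i) = (w.2 (w.1 i) : ℤ) := by
  rw [rootSign, act_smul, act_e, ← smul_neg, ← neg_smul, ← Units.val_neg,
    if_congr (smul_e_mem_posRoots _) rfl rfl, Units.val_neg]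
  rcases units_eq (w.2 (w.1 i)) with h | h <;> rw [h] <;> simp

/-- Changing the sign of the image of the later coordinate swaps the images of the two roots, and
changing that of the earlier one flips the positivity of both or swaps them up to sign. So the
product only sees whether the permutation inverts the pair. -/
theorem rootSign_mul_rootSign {n : ℕ} (w : Weyl n) {i j : Fin n} (hij : i < j) :
    rootSign w (e i - e j) * rootSign w (e i + e j) = if w.1 i < w.1 j then 1 else -1 := by
  rw [rootSign, rootSign, act_sub, act_add, act_e, act_e]
  rcases lt_or_gt_of_ne (fun h => hij.ne (w.1.injective h)) with h | h
  · rw [if_pos h]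
    have h1 := smul_add_smul_mem_posRoots h (-w.2 (w.1 i)) (w.2 (w.1 j))
    have h2 := smul_add_smul_mem_posRoots h (-w.2 (w.1 i)) (-w.2 (w.1 j))
    rw [Units.val_neg, neg_smul] at h1 h2
    rw [Units.val_neg, neg_smul] at h2
    rw [neg_sub, ← neg_add_eq_sub, neg_add, if_congr h1 rfl rfl, if_congr h2 rfl rfl]
    split_ifs <;> rfl
  · rw [if_neg h.not_gt]
    have h1 := smul_add_smul_mem_posRoots h (w.2 (w.1 j)) (-w.2 (w.1 i))
    have h2 := smul_add_smul_mem_posRoots h (-w.2 (w.1 j)) (-w.2 (w.1 i))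
    rw [Units.val_neg, neg_smul] at h1 h2
    rw [Units.val_neg, neg_smul] at h2
    rw [neg_sub, sub_eq_add_neg, neg_add_rev, if_congr h1 rfl rfl, if_congr h2 rfl rfl]
    rcases units_eq (w.2 (w.1 j)) with hu | hu <;> rw [hu] <;> simp

theorem e_apply {n : ℕ} (i j : Fin n) : e i j = if j = i then 1 else 0 := by
  rw [e, Pi.single_apply]

theorem e_injective {n : ℕ} : Function.Injective (e : Fin n → Weight n) := fun i j h => by
  have := congrFun h i
  simpa [e_apply] using this

theorem prod_posRoots {n : ℕ} (g : Weight n → ℤ) :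
    ∏ α ∈ posRoots n, g α =
      (∏ i, ∏ j ∈ Ioi i, g (e i - e j) * g (e i + e j)) * ∏ i, g ((2 : ℤ) • e i) := by
  -- The coordinate sum is 0 on e_i - e_j and 2 on the other positive roots.
  have hsep : ∀ i j : Fin n, i < j → (e i + e j) ⬝ᵥ (1 : Weight n) = 2 := fun i j _ => by
    rw [dotProduct_comm, dotProduct_add, dot_e, dot_e]; rfl
  have hsep' : ∀ i j : Fin n, i < j → (e i - e j) ⬝ᵥ (1 : Weight n) = 0 := fun i j _ => by
    rw [dotProduct_comm, dotProduct_sub, dot_e, dot_e]; rfl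
  have hsep2 : ∀ i : Fin n, ((2 : ℤ) • e i) ⬝ᵥ (1 : Weight n) = 2 := fun i => by
    rw [dotProduct_comm, dotProduct_smul, dot_e]; rfl
  rw [posRoots, prod_union, prod_union, prod_image, prod_image, prod_image]
  · simp only [prod_mul_distrib]
    congr 2 <;> rw [prod_filter, ← univ_product_univ, prod_product] <;>
      refine prod_congr rfl fun i _ => ?_ <;> rw [← prod_filter] <;>
      refine prod_congr ?_ fun _ _ => rfl <;> ext j <;> simp
  · intro i _ j _ h
    exact e_injective (smul_right_injective _ two_ne_zero h)
  · rintro ⟨i, j⟩ hij ⟨a, b⟩ hab h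
    simp only [coe_filter, mem_univ, true_and, Set.mem_ofPred_eq] at hij hab
    have h1 := congrFun h i
    have h2 := congrFun h j
    have h3 := congrFun h a
    have h4 := congrFun h b
    simp only [Pi.add_apply, e_apply, hij.ne, hij.ne', hab.ne, hab.ne', if_true, if_false] at *
    grind
  · rintro ⟨i, j⟩ hij ⟨a, b⟩ hab h
    simp only [coe_filter, mem_univ, true_and, Set.mem_ofPred_eq] at hij hab
    have h1 := congrFun h i
    have h2 := congrFun h j
    simp only [Pi.sub_apply, e_apply, hij.ne, hij.ne', if_true, if_false] at *
    grind
  · rw [disjoint_left]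
    intro α h1 h2
    simp only [mem_image, mem_filter, mem_univ, true_and, Prod.exists] at h1 h2
    obtain ⟨i, j, hij, rfl⟩ := h1
    obtain ⟨a, b, hab, h⟩ := h2
    have := hsep a b hab
    rw [h, hsep' i j hij] at this
    omega
  · rw [disjoint_left]
    intro α h1 h2
    simp only [mem_union, mem_image, mem_filter, mem_univ, true_and, Prod.exists] at h1 h2
    obtain ⟨a, rfl⟩ := h2
    rcases h1 with ⟨i, j, hij, h⟩ | ⟨i, j, hij, h⟩
    · have := hsep' i j hij
      rw [h, hsep2] at this
      omega
    · have h1 := congrFun h i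
      have h2 := congrFun h j
      simp only [Pi.add_apply, Pi.smul_apply, smul_eq_mul, e_apply, hij.ne, hij.ne', if_true,
        if_false] at h1 h2
      grind

/-- Short roots, taken in pairs e_i ± e_j, give the inversions of the permutation; long roots give
the sign changes. -/
theorem neg_one_pow_length {n : ℕ} (w : Weyl n) :
    (-1 : ℤ) ^ length w = (Equiv.Perm.sign w.1 : ℤ) * ∏ i, (w.2 i : ℤ) := by
  have h : (-1 : ℤ) ^ length w = ∏ α ∈ posRoots n, rootSign w α := by
    rw [length, ← prod_const, prod_filter]
    rfl
  rw [h, prod_posRoots, Equiv.Perm.sign_eq_prod_prod_Ioi]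
  congr 1
  · rw [Units.coe_prod]
    refine prod_congr rfl fun i _ => ?_
    rw [Units.coe_prod]
    refine prod_congr rfl fun j hj => ?_
    rw [rootSign_mul_rootSign w (mem_Ioi.1 hj)]
    split_ifs <;> rfl
  · simp only [rootSign_two_smul]
    exact Equiv.prod_comp w.1 (fun i => (w.2 i : ℤ))

/-- The extension changes sign under the shifted reflection in the root `2 e_j`. -/
theorem extend_reflect {n : ℕ} {M : Type*} [AddCommGroup M] (C : Weight n → M) {μ ν : Weight n}
    (j : Fin n) (hj : (ν + rho n) j = -(μ + rho n) j)
    (h : ∀ i, i ≠ j → (ν + rho n) i = (μ + rho n) i) : extend C ν = -extend C μ := by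
  have key : ∀ {μ ν : Weight n}, (ν + rho n) j = -(μ + rho n) j →
      (∀ i, i ≠ j → (ν + rho n) i = (μ + rho n) i) →
      (∃ p : Weyl n × Weight n, Dominant p.2 ∧ act p.1 (μ + rho n) = p.2 + rho n) →
      extend C ν = -extend C μ := by
    rintro μ ν hj h ⟨⟨⟨π, ε⟩, lam⟩, hl, hc⟩
    -- The same permutation works after flipping the one sign at the image of j.
    have hc' : act (π, Function.update ε (π j) (-ε (π j))) (ν + rho n) = lam + rho n := by
      rw [← hc]
      funext i
      by_cases hi : i = π j
      · subst hi
        simp only [act, Function.update_self, Equiv.symm_apply_apply, hj, Units.val_neg, neg_mul_neg]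
      · have : π.symm i ≠ j := fun h' => hi (by rw [← h', Equiv.apply_symm_apply])
        simp only [act, Function.update_of_ne hi, h _ this]
    rw [extend_of_conj C hl hc, extend_of_conj C hl hc', ← neg_smul, neg_one_pow_length,
      neg_one_pow_length]
    congr 1
    rw [← mul_prod_erase _ _ (mem_univ (π j)), ← mul_prod_erase univ (fun i => (ε i : ℤ))
      (mem_univ (π j))]
    simp only [Function.update_self, Units.val_neg]
    rw [prod_congr rfl fun i hi => by rw [Function.update_of_ne (ne_of_mem_erase hi)]]
    ring
  by_cases hex : ∃ p : Weyl n × Weight n, Dominant p.2 ∧ act p.1 (μ + rho n) = p.2 + rho n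
  · exact key hj h hex
  by_cases hex' : ∃ p : Weyl n × Weight n, Dominant p.2 ∧ act p.1 (ν + rho n) = p.2 + rho n
  · rw [key (μ := ν) (ν := μ) (by rw [hj, neg_neg]) (fun i hi => (h i hi).symm) hex', neg_neg]
  · rw [extend, extend, dif_neg hex, dif_neg hex', neg_zero]

theorem units_eq_one_of_act {n : ℕ} {w : Weyl n} {x lam : Weight n} (hx : ∀ i, 0 ≤ x i)
    (hl : Dominant lam) (h : act w x = lam + rho n) : ∀ i, (w.2 i : ℤ) = 1 := by
  intro i
  have hp := hl.pos i
  rw [← h, act] at hp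
  rcases units_eq (w.2 i) with hu | hu
  · exact hu
  · have := hx (w.1.symm i)
    rw [hu] at hp
    omega

/-- The extension of the indicator function of a dominant weight is a determinant. -/
theorem extend_indicator {n : ℕ} {K : Type*} [CommRing K] {lam μ : Weight n} (hl : Dominant lam)
    (hμ : ∀ i, 0 ≤ (μ + rho n) i) :
    extend (fun ν => if ν = lam then (1 : K) else 0) μ =
      (Matrix.of fun i j => if (μ + rho n) i = (lam + rho n) j then (1 : K) else 0).det := by
  rw [Matrix.det_apply']
  simp only [Matrix.of_apply, prod_ite_zero, prod_const_one, mem_univ, true_imp_iff, mul_ite,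
    mul_one, mul_zero]
  by_cases hex : ∃ p : Weyl n × Weight n, Dominant p.2 ∧ act p.1 (μ + rho n) = p.2 + rho n
  · obtain ⟨⟨⟨π, ε⟩, lam'⟩, hl', hc⟩ := hex
    have hε := units_eq_one_of_act hμ hl' hc
    have hc' : ∀ i, (μ + rho n) i = (lam' + rho n) (π i) := fun i => by
      rw [← hc, act, hε, Equiv.symm_apply_apply, one_mul]
    rw [extend_of_conj _ hl' hc, neg_one_pow_length]
    simp only at hε
    simp only [hε, prod_const_one, mul_one]
    split_ifs with hlam
    · subst hlam
      -- The coordinates of `lam + rho n` are distinct, so a single term of the Leibniz expansion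
      -- survives.
      rw [sum_eq_single π⁻¹]
      · rw [if_pos]
        · simp
        · intro i; rw [hc', ← Equiv.Perm.mul_apply, mul_inv_cancel, Equiv.Perm.one_apply]
      · intro τ _ hτ
        rw [if_neg]
        intro h
        apply hτ
        refine Equiv.ext fun i => ?_
        have := hl.strictAnti.injective ((hc' (τ i)).symm.trans (h i))
        exact ((Equiv.symm_apply_eq π).2 this.symm).symm
      · simp
    · rw [smul_zero, sum_eq_zero]
      intro τ _
      rw [if_neg]
      intro h
      apply hlam
      refine (conj_unique (x := μ + rho n) (σ := (π, ε)) (τ := (τ⁻¹, 1)) hl' hl hc ?_).2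
      funext i
      simp only [act, Pi.one_apply, Units.val_one, one_mul, ← h i]
      rfl
  · rw [extend, dif_neg hex, sum_eq_zero]
    intro τ _
    rw [if_neg]
    intro h
    refine hex ⟨((τ⁻¹, 1), lam), hl, ?_⟩
    funext i
    simp only [act, Pi.one_apply, Units.val_one, one_mul, ← h i]
    rfl

/-! ### The pairs of the recurrence as sign vectors with a marked coordinate +1. -/

/-- The weight with the given signs as coordinates. -/
def signWeight {n : ℕ} (s : Fin n → SignType) : Weight n := fun i => (s i : ℤ)

/-- The number of nonzero coordinates. -/
def suppCard {n : ℕ} (s : Fin n → SignType) : ℕ := (univ.filter fun i => s i ≠ 0).card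

theorem signWeight_injective {n : ℕ} : Function.Injective (signWeight : (Fin n → SignType) → _) := by
  intro s s' h
  funext i
  have := congrFun h i
  simp only [signWeight] at this
  revert this
  generalize s i = a
  generalize s' i = b
  revert a b
  decide

theorem sum_signWeight {n : ℕ} (s : Fin n → SignType) :
    ∑ i, signWeight s i = suppCard s - 2 * ((univ.filter fun i => s i = -1).card : ℤ) := by
  rw [suppCard, card_filter, card_filter]
  push_cast
  rw [mul_sum, ← sum_sub_distrib]
  refine sum_congr rfl fun i _ => ?_
  rw [signWeight]
  generalize s i = a
  revert a
  decide

theorem omega_one {n : ℕ} [NeZero n] : omega n 1 = e 0 := by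
  funext i
  rw [omega, e_apply]
  refine if_congr ?_ rfl rfl
  rw [Fin.ext_iff]
  simp

/-- Since e_1 occurs in the weight with coefficient 1, positivity of the root forces the marked
coordinate of its image to be +1; the only other invariant of the orbit is the size of the support.
-/
theorem pairs_omega {n r : ℕ} (hr : 1 ≤ r) (hrn : 2 * r ≤ n) :
    pairs (omega n (2 * r)) =
      ((univ : Finset ((Fin n → SignType) × Fin n)).filter
        fun p => p.1 p.2 = 1 ∧ suppCard p.1 = 2 * r).image fun p => (signWeight p.1, e p.2) := by
  have : NeZero n := ⟨by omega⟩
  ext ⟨μ, b⟩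
  simp only [pairs, mem_filter, mem_image, mem_univ, true_and, Prod.exists, Prod.mk.injEq]
  rw [omega_one]
  constructor
  · rintro ⟨⟨π, ε, h1, h2⟩, h3⟩
    rw [← h2, act_e, smul_e_mem_posRoots] at h3
    rw [act_e, h3, one_smul] at h2
    refine ⟨fun i => SignType.sign (μ i), π 0, ⟨?_, ?_⟩, ?_, h2⟩
    · have : μ (π 0) = 1 := by
        rw [← h1]
        simp only [act, Equiv.symm_apply_apply, omega]
        rw [if_pos (by simp; omega)]
        simpa using h3
      show SignType.sign (μ (π 0)) = 1
      rw [this]; decide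
    · have : (univ.filter fun i => SignType.sign (μ i) ≠ 0) =
          (univ.filter fun i : Fin n => (i : ℕ) < 2 * r).map π.toEmbedding := by
        ext i
        simp only [mem_filter, mem_univ, true_and, mem_map_equiv, sign_ne_zero]
        rw [← h1]
        simp only [act, omega]
        split_ifs with h
        · simp [h]
        · simp [h]
      rw [suppCard, this, card_map, Fin.card_filter_val_lt]
      omega
    · funext i
      rw [signWeight, ← h1]
      simp only [act, omega]
      rcases units_eq (ε i) with h | h <;> rw [h] <;> split_ifs <;> decide
  · rintro ⟨s, j, ⟨hj, hs⟩, rfl, rfl⟩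
    have hcard : Fintype.card {i : Fin n // (i : ℕ) < 2 * r} = Fintype.card {i : Fin n // s i ≠ 0} := by
      rw [Fintype.card_subtype, Fintype.card_subtype, Fin.card_filter_val_lt, ← suppCard, hs]
      omega
    let τ := (Fintype.equivOfCardEq hcard).extendSubtype
    have hτ : ∀ i : Fin n, s (τ i) ≠ 0 ↔ (i : ℕ) < 2 * r := fun i => by
      constructor
      · intro h
        by_contra h'
        exact (Fintype.equivOfCardEq hcard).extendSubtype_not_mem i h' h
      · exact fun h => (Fintype.equivOfCardEq hcard).extendSubtype_mem i h
    have hj0 : s j ≠ 0 := by rw [hj]; decide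
    have h00 : s (τ 0) ≠ 0 := (hτ 0).2 (by simp; omega)
    have hsw : ∀ i, s (Equiv.swap (τ 0) j i) ≠ 0 ↔ s i ≠ 0 := fun i => by
      rw [Equiv.swap_apply_def]
      split_ifs with h h'
      · subst h; exact iff_of_true hj0 h00
      · subst h'; exact iff_of_true h00 hj0
      · rfl
    -- The swap takes place inside the support, so it sends 0 to j without spoiling the
    -- correspondence of supports.
    let π : Equiv.Perm (Fin n) := τ.trans (Equiv.swap (τ 0) j)
    have hπ : ∀ i, s (π i) ≠ 0 ↔ (i : ℕ) < 2 * r := fun i => (hsw _).trans (hτ i)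
    have hπ0 : π 0 = j := by simp [π]
    have h1 : act (π, fun i => if s i = -1 then (-1 : ℤˣ) else 1) (e 0) = e j := by
      rw [act_e]
      simp [hπ0, hj]
    refine ⟨⟨π, fun i => if s i = -1 then -1 else 1, ?_, h1⟩, ?_⟩
    · funext i
      have := hπ (π.symm i)
      rw [Equiv.apply_symm_apply] at this
      simp only [act, omega, ← this, signWeight]
      generalize s i = a
      revert a
      decide
    · exact (mem_posRoots _).2 (Or.inr (Or.inr ⟨j, rfl⟩))

theorem sum_pairs_omega {n r : ℕ} {M : Type*} [AddCommMonoid M] (hr : 1 ≤ r) (hrn : 2 * r ≤ n)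
    (G : Weight n × Weight n → M) :
    ∑ p ∈ pairs (omega n (2 * r)), G p =
      ∑ j, ∑ s ∈ univ.filter (fun s : Fin n → SignType => s j = 1 ∧ suppCard s = 2 * r),
        G (signWeight s, e j) := by
  rw [pairs_omega hr hrn, sum_image]
  · rw [sum_filter, Fintype.sum_prod_type_right]
    simp only [sum_filter]
  · rintro ⟨s, j⟩ _ ⟨s', j'⟩ _ h
    rw [Prod.mk.injEq] at h ⊢
    exact ⟨signWeight_injective h.1, e_injective h.2⟩

theorem ht_e {n : ℕ} (j : Fin n) : ht (e j) = n - j := by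
  rw [ht, dot_e, rho]
  omega

theorem omega_dot_omega_one {n m : ℕ} (hm : 1 ≤ m) (hn : 1 ≤ n) : omega n m ⬝ᵥ omega n 1 = 1 := by
  have : NeZero n := ⟨by omega⟩
  rw [omega_one, dot_e, omega, if_pos (by simp; omega)]

theorem omega_dominant (n m : ℕ) : Dominant (omega n m) := by
  intro α hα
  rcases (mem_posRoots α).1 hα with ⟨i, j, hij, rfl⟩ | ⟨i, j, hij, rfl⟩ | ⟨i, rfl⟩
  · rw [dotProduct_sub, dot_e, dot_e, omega, omega]
    have : (i : ℕ) < j := hij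
    split_ifs <;> omega
  · rw [dotProduct_add, dot_e, dot_e, omega, omega]
    split_ifs <;> omega
  · rw [dotProduct_smul, dot_e, omega]
    split_ifs <;> simp

theorem omega_inj {n a b : ℕ} (ha : a ≤ n) (hb : b ≤ n) (h : omega n a = omega n b) : a = b := by
  by_contra hne
  have hlt : min a b < n := by omega
  have := congrFun h ⟨min a b, hlt⟩
  simp only [omega] at this
  split_ifs at this <;> omega

/-! ### Folding the recurrence into its reduced form. -/

theorem StrictAnti.le_sub {n : ℕ} {u : Weight n} (hu : StrictAnti u) {B : ℤ} (hB : ∀ i, u i ≤ B) :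
    ∀ k (hk : k < n), u ⟨k, hk⟩ ≤ B - k := by
  intro k
  induction k with
  | zero => intro hk; simpa using hB _
  | succ k ih =>
    intro hk
    have h1 := ih (by omega)
    have h2 : u ⟨k + 1, hk⟩ < u ⟨k, by omega⟩ := hu (by rw [Fin.mk_lt_mk]; omega)
    push_cast
    omega

theorem Dominant.nonneg {n : ℕ} {x : Weight n} (hx : Dominant x) (i : Fin n) : 0 ≤ x i := by
  have h := hx ((2 : ℤ) • e i) ((mem_posRoots _).2 (Or.inr (Or.inr ⟨i, rfl⟩)))
  rw [dotProduct_smul, dot_e, smul_eq_mul] at h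
  omega

theorem Dominant.antitone {n : ℕ} {x : Weight n} (hx : Dominant x) : Antitone x := by
  intro i j hij
  rcases hij.eq_or_lt with rfl | hij
  · exact le_rfl
  have h := hx (e i - e j) ((mem_posRoots _).2 (Or.inl ⟨i, j, hij, rfl⟩))
  rw [dotProduct_sub, dot_e, dot_e] at h
  omega

/-- A dominant weight with coordinates at most `1` is a fundamental weight or zero. -/
theorem Dominant.eq_omega {n : ℕ} {x : Weight n} (hx : Dominant x) (h1 : ∀ i, x i ≤ 1) :
    ∃ m ≤ n, x = omega n m ∧ ∑ i, x i = m := by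
  have h01 : ∀ i, x i = if x i = 1 then 1 else 0 := fun i => by
    have := h1 i
    have := hx.nonneg i
    split_ifs <;> omega
  refine ⟨(univ.filter fun i => x i = 1).card, (card_le_univ _).trans_eq (Fintype.card_fin n), ?_, ?_⟩
  · funext i
    rw [h01, omega]
    refine if_congr ⟨fun h => ?_, fun h => ?_⟩ rfl rfl
    · have : Iic i ⊆ univ.filter fun i => x i = 1 := fun k hk => by
        have := hx.antitone (mem_Iic.1 hk)
        have := h1 k
        simp only [mem_filter, mem_univ, true_and]
        omega
      have := card_le_card this
      rw [Fin.card_Iic] at this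
      omega
    · by_contra h'
      have : (univ.filter fun i => x i = 1) ⊆ Iio i := fun k hk => by
        rw [mem_Iio]
        by_contra hik
        have := hx.antitone (not_lt.1 hik)
        have := h1 i
        simp only [mem_filter, mem_univ, true_and] at hk
        omega
      have := card_le_card this
      rw [Fin.card_Iio] at this
      omega
  · rw [card_filter]
    push_cast
    exact sum_congr rfl fun i _ => h01 i

/-- In this range the shifted coordinates lie in [0, n+1], so conjugation is a mere permutation. The
result decreases strictly from at most n + 1, which bounds the dominant weight by 1 in each
coordinate. -/
theorem conj_eq_omega {n r i : ℕ} {s : Fin n → SignType} {j : Fin n} (hj : s j = 1)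
    (hs : suppCard s = 2 * r) (hi : 2 * i ≤ n - j + 1) {w : Weyl n} {lam : Weight n}
    (hl : Dominant lam)
    (h : act w (signWeight s - (i : ℤ) • ((2 : ℤ) • e j) + rho n) = lam + rho n) :
    ∃ m ≤ r, 2 * m ≤ n ∧ lam = omega n (2 * m) := by
  have hs1 : ∀ a : SignType, (a : ℤ) ≤ 1 ∧ -1 ≤ (a : ℤ) := by decide
  have hv : ∀ k, 0 ≤ (signWeight s - (i : ℤ) • ((2 : ℤ) • e j) + rho n) k ∧
      (signWeight s - (i : ℤ) • ((2 : ℤ) • e j) + rho n) k ≤ n + 1 := by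
    intro k
    have h1 := hs1 (s k)
    simp only [Pi.add_apply, Pi.sub_apply, Pi.smul_apply, e_apply, signWeight, rho, smul_eq_mul]
    have := k.2
    split_ifs with hkj
    · subst hkj
      rw [hj, SignType.coe_one]
      omega
    · omega
  have hε := units_eq_one_of_act (fun k => (hv k).1) hl h
  have hlam : ∀ k, (lam + rho n) k =
      (signWeight s - (i : ℤ) • ((2 : ℤ) • e j) + rho n) (w.1.symm k) := fun k => by
    rw [← h, act, hε, one_mul]
  obtain ⟨m, hmn, hm, hsum⟩ := hl.eq_omega fun k => by
    have := StrictAnti.le_sub hl.strictAnti (B := n + 1)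
      (fun k => by rw [hlam]; exact (hv _).2) k k.2
    simp only [Pi.add_apply, rho, Fin.eta] at this
    omega
  -- A permutation keeps the coordinate sum, so the weight has sum 2r - 2i minus twice the number of
  -- negative signs: even and at most 2r.
  have hsum' : ∑ k, (lam + rho n) k =
      ∑ k, (signWeight s - (i : ℤ) • ((2 : ℤ) • e j) + rho n) k := by
    simp only [hlam]
    exact Equiv.sum_comp w.1.symm
      (fun k => (signWeight s - (i : ℤ) • ((2 : ℤ) • e j) + rho n) k)
  simp only [Pi.add_apply, Pi.sub_apply, sum_add_distrib, sum_sub_distrib, hsum, sum_signWeight, hs,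
    Pi.smul_apply, smul_eq_mul, e_apply, mul_ite, mul_one, mul_zero, sum_ite_eq', mem_univ,
    if_true] at hsum'
  push_cast at hsum'
  refine ⟨m / 2, by omega, by omega, ?_⟩
  rw [hm]
  congr 1
  omega

theorem extend_eq_sum {n r i : ℕ} {K M : Type*} [Field K] [AddCommGroup M] [Module K M]
    (C : Weight n → M) (hrn : 2 * r ≤ n) {s : Fin n → SignType} {j : Fin n} (hj : s j = 1)
    (hs : suppCard s = 2 * r) (hi : 2 * i ≤ n - j + 1) :
    extend C (signWeight s - (i : ℤ) • ((2 : ℤ) • e j)) =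
      ∑ h ∈ range (r + 1), extend (fun μ => if μ = omega n (2 * h) then (1 : K) else 0)
        (signWeight s - (i : ℤ) • ((2 : ℤ) • e j)) • C (omega n (2 * h)) := by
  by_cases hex : ∃ p : Weyl n × Weight n, Dominant p.2 ∧
      act p.1 (signWeight s - (i : ℤ) • ((2 : ℤ) • e j) + rho n) = p.2 + rho n
  · obtain ⟨⟨w, lam⟩, hl, hw⟩ := hex
    obtain ⟨m, hmr, -, hm⟩ := conj_eq_omega hj hs hi hl hw
    simp only at hm
    subst hm
    simp only [extend_of_conj _ hl hw]
    rw [sum_eq_single m]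
    · rw [if_pos rfl, smul_assoc, one_smul]
    · intro h hh hne
      rw [if_neg, smul_zero, zero_smul]
      intro heq
      have := omega_inj (by omega) (by rw [mem_range] at hh; omega) heq
      omega
    · intro h
      rw [mem_range] at h
      omega
  · simp only [extend, dif_neg hex, zero_smul, sum_const_zero]

theorem sum_range_eq_two_smul {M : Type*} [AddCommGroup M] (N : ℕ) (φ : ℕ → M)
    (hφ : ∀ i ≤ N + 1, φ (N + 1 - i) = φ i) (hφ0 : ∀ i, 2 * i = N + 1 → φ i = 0) :
    ∑ i ∈ range (N + 2), φ i =
      2 • ∑ i ∈ (range (N + 2)).filter (fun i => 2 * i < N + 1), φ i := by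
  rw [← sum_filter_add_sum_filter_not _ (fun i => 2 * i < N + 1), two_smul]
  congr 1
  rw [← sum_filter_add_sum_filter_not _ (fun i => 2 * i = N + 1), sum_eq_zero, zero_add]
  · refine sum_nbij' (fun i => N + 1 - i) (fun i => N + 1 - i) ?_ ?_ ?_ ?_ ?_ <;>
      simp only [mem_filter, mem_range] <;> intro i hi
    · omega
    · omega
    · omega
    · omega
    · exact (hφ i (by omega)).symm
  · intro i hi
    simp only [mem_filter] at hi
    exact hφ0 i hi.2

theorem qmRecurrence_omega {K M : Type*} [Field K] [AddCommGroup M] [Module K M] {q t : K}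
    (hq : q ≠ 0) (ht0 : t ≠ 0) {n r : ℕ} (hr : 1 ≤ r) (hrn : 2 * r ≤ n) (C : Weight n → M) :
    qmRecurrence (omega n (2 * r)) q t C = (2 : K) • R n r q t C := by
  rw [qmRecurrence, R]
  simp only [Lam, sum_pairs_omega hr hrn, sum_smul, mul_smul,
    omega_dot_omega_one (show 1 ≤ 2 * r by omega) (show 1 ≤ n by omega), ht_e]
  conv_rhs => rw [sum_comm, smul_sum]
  refine sum_congr rfl fun j _ => ?_
  conv_rhs => rw [sum_comm, smul_sum]
  refine sum_congr rfl fun s hs => ?_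
  obtain ⟨hj, hs⟩ := (mem_filter.1 hs).2
  conv_rhs => rw [sum_comm]
  rw [sum_range_eq_two_smul, ofNat_smul_eq_nsmul K]
  · congr 1
    refine sum_congr rfl fun i hi => ?_
    rw [← smul_sum, ← extend_eq_sum C hrn hj hs (mem_filter.1 hi).2.le]
  · intro i hi
    -- Both the coefficient and the extended symbol change sign, so the product is invariant.
    rw [F_reflect _ _ hq ht0 hi, extend_reflect C (μ := signWeight s - (i : ℤ) • ((2 : ℤ) • e j)) j,
      neg_smul_neg]
    · simp only [Pi.add_apply, Pi.sub_apply, Pi.smul_apply, e_apply, signWeight, rho, smul_eq_mul,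
        hj, SignType.coe_one, if_true]
      have := j.2
      omega
    · intro k hk
      simp [e_apply, hk]
  · intro i hi
    -- At the middle index the j-th shifted coordinate is 1 - 2i + N = 0.
    rw [extend_of_not_regular, smul_zero]
    intro hreg
    apply hreg ((2 : ℤ) • e j) ((mem_posRoots _).2 (Or.inr (Or.inr ⟨j, rfl⟩)))
    rw [dotProduct_smul, dot_e]
    simp only [Pi.add_apply, Pi.sub_apply, Pi.smul_apply, e_apply, signWeight, rho, smul_eq_mul,
      hj, SignType.coe_one, if_true]
    have := j.2
    omega

/-! ### Generating matrices and removal of the columns of ω_m. -/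

open Polynomial

/-- The indicator row of the value `v` among the coordinates of `ω_m + ρ`. -/
noncomputable def valueRow (K : Type*) [Field K] (n m : ℕ) (v : ℤ) : Fin n → K[X] := fun j =>
  if v = (omega n m + rho n) j then 1 else 0

/-- The generating matrix of the shifts of the coordinates of `ρ` by `0` and `±1`. -/
noncomputable def shiftMatrix (K : Type*) [Field K] (n m : ℕ) : Matrix (Fin n) (Fin n) K[X] :=
  Matrix.of fun i => valueRow K n m (n - i) +
    (X : K[X]) • (valueRow K n m (n - i + 1) + valueRow K n m (n - i - 1))

/-- The row of the coefficients `F_l` at height `N`. -/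
noncomputable def coeffRow {K : Type*} [Field K] (q t : K) (n m N : ℕ) : Fin n → K[X] :=
  ∑ l ∈ (range (N + 2)).filter (fun l => 2 * l < N + 1),
    C (F 1 N l q t) • ((X : K[X]) • valueRow K n m (N + 1 - 2 * l))

/-- The generating polynomial of the coefficients of the reduced recurrences. -/
noncomputable def genLam {K : Type*} [Field K] (q t : K) (n m : ℕ) : K[X] :=
  ∑ i : Fin n, ((shiftMatrix K n m).updateRow i (coeffRow q t n m (n - i))).det

theorem valueRow_succ {K : Type*} [Field K] (n m : ℕ) (v : ℤ) (j : Fin n) :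
    valueRow K (n + 1) (m + 1) v j.succ = valueRow K n m v j := by
  have h : (omega (n + 1) (m + 1) + rho (n + 1)) j.succ = (omega n m + rho n) j := by
    simp only [Pi.add_apply, omega, rho, Fin.val_succ]
    split_ifs <;> omega
  rw [valueRow, valueRow, h]

theorem valueRow_succ_zero {K : Type*} [Field K] (n m : ℕ) (v : ℤ) :
    valueRow K (n + 1) (m + 1) v 0 = if v = n + 2 then 1 else 0 := by
  have h : (omega (n + 1) (m + 1) + rho (n + 1)) 0 = n + 2 := by
    simp only [Pi.add_apply, omega, rho, Fin.val_zero]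
    split_ifs <;> omega
  rw [valueRow, h]

theorem valueRow_zero_succ {K : Type*} [Field K] (n : ℕ) (v : ℤ) (j : Fin n) :
    valueRow K (n + 1) 0 v j.succ = valueRow K n 0 v j := by
  simp only [valueRow, Pi.add_apply, omega, rho, Fin.val_succ, not_lt_zero, if_false]
  push_cast
  rw [add_sub_add_right_eq_sub]

theorem shiftMatrix_submatrix {K : Type*} [Field K] (n m : ℕ) :
    (shiftMatrix K (n + 1) (m + 1)).submatrix Fin.succ Fin.succ = shiftMatrix K n m := by
  ext1 i j
  simp only [shiftMatrix, Matrix.submatrix_apply, Matrix.of_apply, Pi.add_apply, Pi.smul_apply,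
    valueRow_succ, Fin.val_succ]
  push_cast
  rw [add_sub_add_right_eq_sub]

theorem shiftMatrix_zero_submatrix {K : Type*} [Field K] (n : ℕ) :
    (shiftMatrix K (n + 1) 0).submatrix Fin.succ Fin.succ = shiftMatrix K n 0 := by
  ext1 i j
  simp only [shiftMatrix, Matrix.submatrix_apply, Matrix.of_apply, Pi.add_apply, Pi.smul_apply,
    valueRow_zero_succ, Fin.val_succ]
  push_cast
  rw [add_sub_add_right_eq_sub]

theorem coeffRow_succ {K : Type*} [Field K] (q t : K) (n m N : ℕ) (j : Fin n) :
    coeffRow q t (n + 1) (m + 1) N j.succ = coeffRow q t n m N j := by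
  simp only [coeffRow, Finset.sum_apply, Pi.smul_apply, valueRow_succ]

theorem det_eq_mul_of_column_zero {R : Type*} [CommRing R] {n : ℕ}
    (A : Matrix (Fin (n + 1)) (Fin (n + 1)) R) (h : ∀ i : Fin n, A i.succ 0 = 0) :
    A.det = A 0 0 * (A.submatrix Fin.succ Fin.succ).det := by
  rw [Matrix.det_succ_column_zero, Fin.sum_univ_succ, sum_eq_zero, add_zero]
  · simp [Fin.succAbove_zero]
  · intro i _
    rw [h, mul_zero, zero_mul]

theorem shiftMatrix_succ_zero {K : Type*} [Field K] (n m : ℕ) (i : Fin n) :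
    shiftMatrix K (n + 1) (m + 1) i.succ 0 = 0 := by
  simp only [shiftMatrix, Matrix.of_apply, Pi.add_apply, Pi.smul_apply, valueRow_succ_zero,
    Fin.val_succ]
  push_cast
  rw [if_neg (by omega), if_neg (by omega), if_neg (by omega)]
  simp

theorem shiftMatrix_zero_zero {K : Type*} [Field K] (n m : ℕ) :
    shiftMatrix K (n + 1) (m + 1) 0 0 = X := by
  simp only [shiftMatrix, Matrix.of_apply, Pi.add_apply, Pi.smul_apply, valueRow_succ_zero,
    Fin.val_zero]
  push_cast
  rw [if_neg (by omega), if_pos (by omega), if_neg (by omega)]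
  simp

theorem det_shiftMatrix_succ {K : Type*} [Field K] (n m : ℕ) :
    (shiftMatrix K (n + 1) (m + 1)).det = X * (shiftMatrix K n m).det := by
  rw [det_eq_mul_of_column_zero _ (shiftMatrix_succ_zero n m), shiftMatrix_zero_zero,
    shiftMatrix_submatrix]

theorem coeffRow_apply_zero {K : Type*} [Field K] (q t : K) (n m : ℕ) :
    coeffRow q t (n + 1) (m + 1) (n + 1) 0 = X * C (leadF q t (n + 1)) := by
  simp only [coeffRow, Finset.sum_apply, Pi.smul_apply, valueRow_succ_zero]
  rw [sum_eq_single 0]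
  · rw [if_pos (by push_cast; ring), F_zero q t (Nat.succ_pos n)]
    rw [smul_eq_mul, smul_eq_mul, mul_one, mul_comm]
  · intro l _ hl
    rw [if_neg (by push_cast; omega)]
    simp
  · intro h
    simp at h

/-- Column 0 stands for the value n + 2, which only row 0 can reach: with entry X in the shift
matrix, and through the term l = 0 in the replaced row. -/
theorem genLam_succ {K : Type*} [Field K] (q t : K) (n m : ℕ) :
    genLam q t (n + 1) (m + 1) =
      X * (genLam q t n m + C (leadF q t (n + 1)) * (shiftMatrix K n m).det) := by
  rw [genLam, Fin.sum_univ_succ, det_eq_mul_of_column_zero]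
  · rw [Matrix.updateRow_self, Fin.val_zero, Nat.sub_zero, coeffRow_apply_zero]
    have h0 : ∀ r, ((shiftMatrix K (n + 1) (m + 1)).updateRow 0 r).submatrix Fin.succ Fin.succ =
        shiftMatrix K n m := fun r => by
      rw [← shiftMatrix_submatrix n m]
      ext1 i j
      simp only [Matrix.submatrix_apply]
      rw [Matrix.updateRow_ne (Fin.succ_ne_zero i)]
    have h1 : ∀ i : Fin n, ((shiftMatrix K (n + 1) (m + 1)).updateRow i.succ
        (coeffRow q t (n + 1) (m + 1) (n + 1 - i.succ))).det =
        X * ((shiftMatrix K n m).updateRow i (coeffRow q t n m (n - i))).det := fun i => by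
      rw [det_eq_mul_of_column_zero, Matrix.updateRow_ne (Fin.succ_ne_zero i).symm,
        shiftMatrix_zero_zero]
      · congr 2
        ext1 k j
        rw [Matrix.submatrix_apply]
        by_cases hk : k = i
        · subst hk
          rw [Matrix.updateRow_self, Matrix.updateRow_self, coeffRow_succ, Fin.val_succ,
            Nat.add_sub_add_right]
        · rw [Matrix.updateRow_ne hk, Matrix.updateRow_ne (fun h => hk (Fin.succ_injective _ h)),
            ← shiftMatrix_submatrix n m, Matrix.submatrix_apply]
      · intro k
        by_cases hk : k = i
        · subst hk
          rw [Matrix.updateRow_self, coeffRow, Finset.sum_apply, sum_eq_zero]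
          intro l _
          rw [Pi.smul_apply, Pi.smul_apply, valueRow_succ_zero, if_neg, smul_zero, smul_zero]
          rw [Fin.val_succ, Nat.add_sub_add_right]
          have := k.2
          omega
        · rw [Matrix.updateRow_ne (fun h => hk (Fin.succ_injective _ h)), shiftMatrix_succ_zero]
    simp only [h0, h1]
    rw [← mul_sum, ← genLam]
    ring
  · intro i
    rw [Matrix.updateRow_ne (Fin.succ_ne_zero i), shiftMatrix_succ_zero]

theorem det_shiftMatrix_add {K : Type*} [Field K] (n m : ℕ) :
    (shiftMatrix K (n + m) m).det = X ^ m * (shiftMatrix K n 0).det := by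
  induction m with
  | zero => simp
  | succ m ih => rw [← add_assoc, det_shiftMatrix_succ, ih]; ring

theorem genLam_add {K : Type*} [Field K] (q t : K) (n m : ℕ) :
    genLam q t (n + m) m = X ^ m * (genLam q t n 0 +
      C (∑ a ∈ range m, leadF q t (n + a + 1)) * (shiftMatrix K n 0).det) := by
  induction m with
  | zero => simp
  | succ m ih =>
    rw [← add_assoc, genLam_succ, ih, det_shiftMatrix_add, sum_range_succ, C_add]
    ring

/-! ### The tridiagonal determinants and their cofactors. -/

/-- The determinants of the tridiagonal matrices with ones on the diagonal and `X` next to it. -/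
noncomputable def triDet (K : Type*) [Field K] : ℕ → K[X]
  | 0 => 0
  | 1 => 1
  | p + 2 => triDet K (p + 1) - X ^ 2 * triDet K p

theorem triDet_add_two (K : Type*) [Field K] (p : ℕ) :
    triDet K (p + 2) = triDet K (p + 1) - X ^ 2 * triDet K p := by
  rw [triDet]

/-- `triDet K (p + 1)` is the determinant of size p; this cuts the matrix of size a + b into
diagonal blocks of sizes a and b, the correction being the transposition across the cut. -/
theorem triDet_add (K : Type*) [Field K] (a b : ℕ) :
    triDet K (a + 1) * triDet K (b + 1) - X ^ 2 * (triDet K a * triDet K b) =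
      triDet K (a + b + 1) := by
  induction a using Nat.twoStepInduction with
  | zero => simp [triDet]
  | one =>
    rw [show 1 + b + 1 = b + 2 by ring, triDet_add_two, triDet_add_two]
    simp [triDet]
  | more a ih1 ih2 =>
    rw [show a + 2 + b + 1 = a + b + 1 + 2 by ring, triDet_add_two K (a + b + 1),
      show a + b + 1 + 1 = a + 1 + b + 1 by ring, ← ih1, ← ih2, triDet_add_two K (a + 1),
      triDet_add_two K a]
    ring

/-- The binomial counts the s-edge matchings of a path with m vertices, each edge contributing -X².
-/
theorem coeff_triDet (K : Type*) [Field K] (m s : ℕ) :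
    (triDet K (m + 1)).coeff (2 * s) = (-1) ^ s * ((m - s).choose s : K) := by
  induction m using Nat.twoStepInduction generalizing s with
  | zero =>
    rcases s with _ | s
    · simp [triDet]
    · simp [triDet, coeff_one]
  | one =>
    rcases s with _ | s
    · simp [triDet]
    · have : triDet K (1 + 1) = 1 := by simp [triDet]
      rw [this, coeff_one, if_neg (by omega), Nat.choose_eq_zero_of_lt (by omega)]
      simp
  | more m ih1 ih2 =>
    rw [triDet_add_two, coeff_sub]
    rcases s with _ | s
    · rw [mul_coeff_zero]
      simpa using ih2 0
    · rw [show 2 * (s + 1) = 2 * s + 2 by ring, coeff_X_pow_mul, ih1, show 2 * s + 2 = 2 * (s + 1) by ring,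
        ih2]
      rcases le_or_gt s m with h | h
      · rw [show m + 2 - (s + 1) = m - s + 1 by omega, show m + 1 - (s + 1) = m - s by omega,
          Nat.choose_succ_succ]
        push_cast
        ring
      · rw [Nat.choose_eq_zero_of_lt (show m + 1 - (s + 1) < s + 1 by omega),
          Nat.choose_eq_zero_of_lt (show m - s < s by omega),
          Nat.choose_eq_zero_of_lt (show m + 2 - (s + 1) < s + 1 by omega)]
        simp

theorem triDet_succ_ne_zero (K : Type*) [Field K] (m : ℕ) : triDet K (m + 1) ≠ 0 := by
  intro h
  have := coeff_triDet K m 0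
  rw [h] at this
  simp at this

theorem shiftMatrix_zero_apply {K : Type*} [Field K] (n : ℕ) (i j : Fin n) :
    shiftMatrix K n 0 i j = if i = j then 1 else if (i : ℕ) = j + 1 ∨ (j : ℕ) = i + 1 then X else 0 := by
  simp only [shiftMatrix, Matrix.of_apply, Pi.add_apply, Pi.smul_apply, valueRow, omega, rho,
    not_lt_zero, if_false, Fin.ext_iff]
  split_ifs <;> first | omega | simp

theorem det_shiftMatrix_zero {K : Type*} [Field K] (n : ℕ) :
    (shiftMatrix K n 0).det = triDet K (n + 1) := by
  induction n using Nat.twoStepInduction with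
  | zero => simp [triDet]
  | one => simp [triDet, shiftMatrix_zero_apply]
  | more n ih1 ih2 =>
    rw [triDet_add_two, ← ih1, ← ih2, Matrix.det_succ_row_zero, Fin.sum_univ_succ, Fin.sum_univ_succ,
      sum_eq_zero, add_zero, Fin.succAbove_zero, shiftMatrix_zero_submatrix,
      det_eq_mul_of_column_zero ((shiftMatrix K (n + 2) 0).submatrix Fin.succ (Fin.succAbove _))]
    · have h : (((shiftMatrix K (n + 2) 0).submatrix Fin.succ
          ((Fin.succ (0 : Fin (n + 1))).succAbove)).submatrix Fin.succ Fin.succ) =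
          shiftMatrix K n 0 := by
        rw [← shiftMatrix_zero_submatrix n, ← shiftMatrix_zero_submatrix (n + 1)]
        ext1 i j
        simp only [Matrix.submatrix_apply, Fin.succ_succAbove_succ, Fin.succAbove_zero]
      rw [h]
      simp only [Matrix.submatrix_apply, shiftMatrix_zero_apply]
      simp
      ring
    · intro i
      simp [shiftMatrix_zero_apply, Fin.ext_iff]
    · intro i _
      rw [shiftMatrix_zero_apply, if_neg, if_neg, mul_zero, zero_mul]
      · simp
      · simp [Fin.ext_iff]

/-- The cofactors of the tridiagonal matrix, indexed by the coordinates of `ρ`. -/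
noncomputable def triCofactor (K : Type*) [Field K] (n a b : ℕ) : K[X] :=
  (-X) ^ (max a b - min a b) * triDet K (min a b) * triDet K (n + 1 - max a b)

theorem triCofactor_of_le (K : Type*) [Field K] {n a b : ℕ} (h : a ≤ b) :
    triCofactor K n a b = (-X) ^ (b - a) * triDet K a * triDet K (n + 1 - b) := by
  rw [triCofactor, max_eq_right h, min_eq_left h]

theorem triCofactor_of_ge (K : Type*) [Field K] {n a b : ℕ} (h : b ≤ a) :
    triCofactor K n a b = (-X) ^ (a - b) * triDet K b * triDet K (n + 1 - a) := by
  rw [triCofactor, max_eq_left h, min_eq_right h]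

theorem triCofactor_recurrence (K : Type*) [Field K] {n a b : ℕ} (ha : a + 1 ≤ n) (hb : b ≤ n) :
    triCofactor K n (a + 1) b + X * (triCofactor K n (a + 2) b + triCofactor K n a b) =
      if a + 1 = b then triDet K (n + 1) else 0 := by
  rcases lt_trichotomy (a + 1) b with h | h | h
  · obtain ⟨k, rfl⟩ : ∃ k, b = a + 2 + k := ⟨b - (a + 2), by omega⟩
    rw [if_neg h.ne, triCofactor_of_le K (by omega), triCofactor_of_le K (by omega),
      triCofactor_of_le K (by omega), show a + 2 + k - (a + 1) = k + 1 by omega,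
      show a + 2 + k - (a + 2) = k by omega, show a + 2 + k - a = k + 2 by omega,
      triDet_add_two]
    ring
  · subst h
    obtain ⟨k, rfl⟩ : ∃ k, n = a + 1 + k := ⟨n - (a + 1), by omega⟩
    rw [if_pos rfl, triCofactor_of_le K le_rfl, triCofactor_of_ge K (by omega),
      triCofactor_of_le K (by omega), show a + 1 + k + 1 - (a + 1) = k + 1 by omega,
      show a + 1 + k + 1 - (a + 2) = k by omega, show a + 2 - (a + 1) = 1 by omega,
      show a + 1 - a = 1 by omega, Nat.sub_self]
    have h1 := triDet_add K (a + 1) k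
    have h2 := triDet_add K a k
    rw [← h1, triDet_add_two]
    ring
  · obtain ⟨k, rfl⟩ : ∃ k, a = b + k := ⟨a - b, by omega⟩
    obtain ⟨l, rfl⟩ : ∃ l, n = b + k + 1 + l := ⟨n - (b + k + 1), by omega⟩
    rw [if_neg (by omega), triCofactor_of_ge K (by omega), triCofactor_of_ge K (by omega),
      triCofactor_of_ge K (by omega), show b + k + 1 - b = k + 1 by omega,
      show b + k + 2 - b = k + 2 by omega, show b + k - b = k by omega,
      show b + k + 1 + l + 1 - (b + k + 1) = l + 1 by omega,
      show b + k + 1 + l + 1 - (b + k + 2) = l by omega,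
      show b + k + 1 + l + 1 - (b + k) = l + 2 by omega, triDet_add_two]
    ring

/-- The values 0 and n + 1 are not coordinates of ρ, so their rows vanish; the boundary conditions
on φ make the formula uniform. -/
theorem sum_valueRow_mul {K : Type*} [Field K] {n : ℕ} (φ : ℕ → K[X]) (h0 : φ 0 = 0)
    (hn : φ (n + 1) = 0) {v : ℕ} (hv : v ≤ n + 1) {z : ℤ} (hz : z = v) :
    ∑ j : Fin n, valueRow K n 0 z j * φ (n - j) = φ v := by
  subst hz
  simp only [valueRow, Pi.add_apply, omega, rho, not_lt_zero, if_false, zero_add, ite_mul, one_mul,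
    zero_mul]
  rcases Nat.eq_zero_or_pos v with rfl | hv0
  · rw [h0, sum_eq_zero]
    intro j _
    rw [if_neg (by omega)]
  rcases hv.eq_or_lt with rfl | hv
  · rw [hn, sum_eq_zero]
    intro j _
    rw [if_neg (by omega)]
  rw [sum_eq_single ⟨n - v, by omega⟩]
  · rw [if_pos (by simp only; omega)]
    congr 1
    simp only
    omega
  · intro j _ hj
    rw [if_neg]
    intro h
    apply hj
    rw [Fin.ext_iff]
    simp only
    omega
  · simp

theorem triCofactor_zero (K : Type*) [Field K] (n b : ℕ) : triCofactor K n 0 b = 0 := by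
  rw [triCofactor_of_le K (Nat.zero_le b)]
  simp [triDet]

theorem triCofactor_succ_self (K : Type*) [Field K] {n b : ℕ} (hb : b ≤ n) :
    triCofactor K n (n + 1) b = 0 := by
  rw [triCofactor_of_ge K (by omega), Nat.sub_self]
  simp [triDet]

theorem adjugate_shiftMatrix_zero (K : Type*) [Field K] (n : ℕ) :
    (shiftMatrix K n 0).adjugate =
      Matrix.of fun i j : Fin n => triCofactor K n (n - i) (n - j) := by
  have hmul : shiftMatrix K n 0 * (Matrix.of fun i j : Fin n => triCofactor K n (n - i) (n - j)) =
      triDet K (n + 1) • (1 : Matrix (Fin n) (Fin n) K[X]) := by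
    ext1 i k
    have hi := i.2
    have h := fun {v : ℕ} (hv : v ≤ n + 1) {z : ℤ} (hz : z = v) =>
      sum_valueRow_mul (fun a => triCofactor K n a (n - k)) (triCofactor_zero K n (n - k))
        (triCofactor_succ_self K (Nat.sub_le n k)) hv hz
    rw [Matrix.mul_apply]
    simp only [shiftMatrix, Matrix.of_apply, Pi.add_apply, Pi.smul_apply, smul_eq_mul, add_mul,
      mul_assoc, sum_add_distrib, ← mul_sum]
    obtain ⟨a, ha⟩ : ∃ a, n - (i : ℕ) = a + 1 := ⟨n - i - 1, by omega⟩
    rw [h (v := a + 1) (by omega) (by omega), h (v := a + 2) (by omega) (by omega),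
      h (v := a) (by omega) (by omega), triCofactor_recurrence K (by omega) (Nat.sub_le n k),
      Matrix.smul_apply, Matrix.one_apply, smul_eq_mul, mul_ite, mul_one, mul_zero]
    refine if_congr ?_ rfl rfl
    rw [Fin.ext_iff]
    omega
  have h := congrArg ((shiftMatrix K n 0).adjugate * ·) hmul
  rw [← Matrix.mul_assoc, Matrix.adjugate_mul, det_shiftMatrix_zero, Matrix.smul_mul,
    Matrix.mul_smul, Matrix.one_mul, Matrix.mul_one] at h
  -- The determinant can be cancelled, its constant term being 1.
  exact (smul_right_injective _ (triDet_succ_ne_zero K n) h).symm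

/-! ### The generating polynomial for m = 0 and its recurrence in n. -/

theorem det_updateRow_eq_sum {R : Type*} [CommRing R] {n : ℕ} (A : Matrix (Fin n) (Fin n) R)
    (i : Fin n) (b : Fin n → R) : (A.updateRow i b).det = ∑ j, b j * A.adjugate j i := by
  rw [← Matrix.cramer_transpose_apply, Matrix.cramer_eq_adjugate_mulVec, ← Matrix.adjugate_transpose,
    Matrix.mulVec, dotProduct]
  simp only [Matrix.transpose_apply, mul_comm]

theorem genLam_zero_eq_sum {K : Type*} [Field K] (q t : K) (n : ℕ) :
    genLam q t n 0 = ∑ N ∈ range n, ∑ l ∈ range ((N + 3) / 2),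
      C (F 1 (N + 1) l q t) * (X * triCofactor K n (N + 2 - 2 * l) (N + 1)) := by
  rw [genLam, ← sum_range_reflect, ← Fin.sum_univ_eq_sum_range (fun j => ∑ l ∈
    range ((n - 1 - j + 3) / 2), C (F 1 (n - 1 - j + 1) l q t) *
      (X * triCofactor K n (n - 1 - j + 2 - 2 * l) (n - 1 - j + 1))) n]
  refine sum_congr rfl fun i _ => ?_
  obtain ⟨N, hN⟩ : ∃ N, n - (i : ℕ) = N + 1 := ⟨n - i - 1, by have := i.2; omega⟩
  have hN' : n - 1 - (i : ℕ) = N := by omega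
  rw [det_updateRow_eq_sum, adjugate_shiftMatrix_zero, hN, hN', coeffRow]
  have hr : (range (N + 1 + 2)).filter (fun l => 2 * l < N + 1 + 1) = range ((N + 3) / 2) := by
    ext l
    simp only [mem_filter, mem_range]
    omega
  simp only [hr, Finset.sum_apply, Pi.smul_apply, smul_eq_mul, sum_mul, Matrix.of_apply]
  rw [sum_comm]
  refine sum_congr rfl fun l hl => ?_
  rw [mem_range] at hl
  simp only [mul_assoc, ← mul_sum, hN]
  rw [sum_valueRow_mul (fun a => triCofactor K n a (N + 1)) (triCofactor_zero K n (N + 1))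
    (triCofactor_succ_self K (by omega)) (v := N + 2 - 2 * l) (by omega) (by push_cast; omega)]

/-- The contribution of the coefficients `F_i`, `i ≥ 2`, at height `N + 1`. -/
noncomputable def tailSum {K : Type*} [Field K] (q t : K) (N : ℕ) : K[X] :=
  ∑ k ∈ range ((N - 1) / 2), X ^ (2 * (k + 1)) *
    (C (primF q t (N - 2 * (k + 1)) - primF q t (N - 2 * (k + 1) + 1)) *
      triDet K (N - 2 * (k + 1)))

theorem tailSum_add_two {K : Type*} [Field K] (q t : K) (N : ℕ) :
    tailSum q t (N + 2) =
      X ^ 2 * (C (primF q t N - primF q t (N + 1)) * triDet K N + tailSum q t N) := by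
  rcases N with _ | N
  · simp [tailSum, triDet]
  · have h : ∀ k ∈ range ((N + 1 - 1) / 2), X ^ (2 * (k + 1 + 1)) *
        (C (primF q t (N + 1 + 2 - 2 * (k + 1 + 1)) - primF q t (N + 1 + 2 - 2 * (k + 1 + 1) + 1)) *
          triDet K (N + 1 + 2 - 2 * (k + 1 + 1))) = X ^ 2 * (X ^ (2 * (k + 1)) *
        (C (primF q t (N + 1 - 2 * (k + 1)) - primF q t (N + 1 - 2 * (k + 1) + 1)) *
          triDet K (N + 1 - 2 * (k + 1)))) := by
      intro k _
      rw [show N + 1 + 2 - 2 * (k + 1 + 1) = N + 1 - 2 * (k + 1) by omega]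
      ring
    rw [tailSum, show (N + 1 + 2 - 1) / 2 = (N + 1 - 1) / 2 + 1 by omega, sum_range_succ',
      sum_congr rfl h, ← mul_sum, show N + 1 + 2 - 2 * (0 + 1) = N + 1 by omega, ← tailSum]
    ring

/-- The terms l = 0 and l = 1 carry the `leadF` parts, arranged as a difference in N that telescopes
on summing over the rows; the terms l ≥ 2 form `tailSum`. -/
theorem sum_F_mul_triCofactor {K : Type*} [Field K] {q t : K} (hq : q ≠ 0) (ht0 : t ≠ 0)
    {n N : ℕ} (hN : N < n) :
    ∑ l ∈ range ((N + 3) / 2), C (F 1 (N + 1) l q t) *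
        (X * triCofactor K n (N + 2 - 2 * l) (N + 1)) =
      -X ^ 2 * ((C (leadF q t (N + 1)) * triDet K (N + 1) * triDet K (n - (N + 1)) -
        C (leadF q t N) * triDet K N * triDet K (n - N)) +
        (C (primF q t N) * triDet K N + tailSum q t N) * triDet K (n - N)) := by
  have h0 : C (F 1 (N + 1) 0 q t) * (X * triCofactor K n (N + 2 - 2 * 0) (N + 1)) =
      -X ^ 2 * (C (leadF q t (N + 1)) * triDet K (N + 1) * triDet K (n - (N + 1))) := by
    rw [F_zero q t (by omega), triCofactor_of_ge K (by omega),
      show N + 2 - 2 * 0 - (N + 1) = 1 by omega,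
      show n + 1 - (N + 2 - 2 * 0) = n - (N + 1) by omega]
    ring
  rcases N with _ | N
  · rw [show (0 + 3) / 2 = 1 by norm_num, sum_range_one, h0]
    simp [triDet, tailSum]
  · rw [show (N + 1 + 3) / 2 = (N + 1 - 1) / 2 + 1 + 1 by omega, sum_range_succ', h0,
      sum_range_succ', F_one hq ht0 (by omega), triCofactor_of_le K (by omega), tailSum]
    rw [show N + 1 + 1 - (N + 1 + 2 - 2 * (0 + 1)) = 1 by omega,
      show N + 1 + 2 - 2 * (0 + 1) = N + 1 by omega,
      show n + 1 - (N + 1 + 1) = n - (N + 1) by omega]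
    have h2 : ∀ k ∈ range ((N + 1 - 1) / 2), C (F 1 (N + 1 + 1) (k + 1 + 1) q t) *
        (X * triCofactor K n (N + 1 + 2 - 2 * (k + 1 + 1)) (N + 1 + 1)) =
        -X ^ 2 * (X ^ (2 * (k + 1)) *
          (C (primF q t (N + 1 - 2 * (k + 1)) - primF q t (N + 1 - 2 * (k + 1) + 1)) *
          triDet K (N + 1 - 2 * (k + 1))) * triDet K (n - (N + 1))) := by
      intro k hk
      rw [mem_range] at hk
      rw [F_add_two hq ht0 (x := N + 1 - 2 * (k + 1)) (by omega) (by omega),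
        triCofactor_of_le K (by omega),
        show N + 1 + 1 - (N + 1 + 2 - 2 * (k + 1 + 1)) = 2 * (k + 1) + 1 by omega,
        show N + 1 + 2 - 2 * (k + 1 + 1) = N + 1 - 2 * (k + 1) by omega,
        show n + 1 - (N + 1 + 1) = n - (N + 1) by omega, pow_succ (-X),
        Even.neg_pow (even_two_mul _)]
      ring
    rw [sum_congr rfl h2, ← mul_sum, ← sum_mul, C_sub]
    ring

/-- The convolution that gives the generating polynomial for `m = 0`, up to the factor `-X²`. -/
noncomputable def primConv {K : Type*} [Field K] (q t : K) (n : ℕ) : K[X] :=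
  ∑ N ∈ range (n + 1), (C (primF q t N) * triDet K N + tailSum q t N) * triDet K (n - N)

/-- The telescoped boundary terms contain `triDet K 0` and vanish, as does the summand N = n added
in `primConv`. -/
theorem genLam_zero {K : Type*} [Field K] {q t : K} (hq : q ≠ 0) (ht0 : t ≠ 0) (n : ℕ) :
    genLam q t n 0 = -X ^ 2 * primConv q t n := by
  rw [genLam_zero_eq_sum, sum_congr rfl fun N hN => sum_F_mul_triCofactor hq ht0 (mem_range.1 hN),
    ← mul_sum, sum_add_distrib,
    sum_range_sub (fun N => C (leadF q t N) * triDet K N * triDet K (n - N)), primConv,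
    sum_range_succ]
  simp [triDet]

/-- After shifting N, each `primF q t (N + 1)` multiplies the left side of `triDet_add`, which is
the same polynomial for every N. -/
theorem primConv_add_two {K : Type*} [Field K] (q t : K) (n : ℕ) :
    primConv q t (n + 2) = X ^ 2 * primConv q t n +
      triDet K (n + 1) * C (∑ x ∈ range (n + 1), primF q t (x + 1)) := by
  have hp : ∑ N ∈ range (n + 3), C (primF q t N) * triDet K N * triDet K (n + 2 - N) =
      ∑ N ∈ range (n + 1), C (primF q t (N + 1)) * (triDet K (N + 1) * triDet K (n - N + 1)) := by
    rw [sum_range_succ', sum_range_succ]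
    have h0 : triDet K (n + 2 - (n + 1 + 1)) = 0 := by rw [Nat.sub_self, triDet]
    rw [h0, mul_zero, add_zero, triDet, mul_zero, zero_mul, add_zero]
    refine sum_congr rfl fun N hN => ?_
    rw [mem_range] at hN
    rw [show n + 2 - (N + 1) = n - N + 1 by omega]
    ring
  have hj : ∑ N ∈ range (n + 3), tailSum q t N * triDet K (n + 2 - N) =
      ∑ N ∈ range (n + 1), tailSum q t (N + 2) * triDet K (n - N) := by
    rw [sum_range_succ', sum_range_succ']
    have h0 : tailSum q t 0 = 0 := by simp [tailSum]
    have h1 : tailSum q t (0 + 1) = 0 := by simp [tailSum]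
    rw [h0, h1, zero_mul, zero_mul, add_zero, add_zero]
    refine sum_congr rfl fun N _ => ?_
    rw [show n + 2 - (N + 1 + 1) = n - N by omega]
  rw [primConv, primConv]
  simp only [add_mul, sum_add_distrib]
  rw [hp, hj, map_sum, mul_sum, mul_add, mul_sum, mul_sum, ← sum_add_distrib, ← sum_add_distrib,
    ← sum_add_distrib]
  refine sum_congr rfl fun N hN => ?_
  rw [mem_range] at hN
  have h := triDet_add K N (n - N)
  rw [show N + (n - N) + 1 = n + 1 by omega] at h
  rw [← h, tailSum_add_two, C_sub]
  ring

theorem genLam_zero_add_two {K : Type*} [Field K] {q t : K} (hq : q ≠ 0) (ht0 : t ≠ 0) (n : ℕ) :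
    genLam q t (n + 2) 0 = X ^ 2 * genLam q t n 0 -
      X ^ 2 * (triDet K (n + 1) * C (∑ x ∈ range (n + 1), primF q t (x + 1))) := by
  rw [genLam_zero hq ht0, genLam_zero hq ht0, primConv_add_two]
  ring

/-! ### The coefficients of the generating polynomial are the Λ. -/

theorem det_valueRow_eq_extend {K : Type*} [Field K] {n m : ℕ} {μ : Weight n}
    (hμ : ∀ i, 0 ≤ (μ + rho n) i) :
    (Matrix.of fun i => valueRow K n m ((μ + rho n) i)).det =
      C (extend (fun ν => if ν = omega n m then (1 : K) else 0) μ) := by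
  rw [extend_indicator (omega_dominant n m) hμ, RingHom.map_det]
  congr 1
  ext1 i j
  rw [RingHom.mapMatrix_apply, Matrix.map_apply, Matrix.of_apply, Matrix.of_apply, valueRow]
  split_ifs <;> simp

theorem shiftMatrix_row {K : Type*} [Field K] (n m : ℕ) (i : Fin n) :
    shiftMatrix K n m i =
      ∑ a : SignType, (X : K[X]) ^ (if a = 0 then 0 else 1) • valueRow K n m (n - i + (a : ℤ)) := by
  have h : ∀ g : SignType → (Fin n → K[X]), ∑ a, g a = g 0 + (g 1 + g (-1)) := fun g => by
    have : (univ : Finset SignType) = {0, 1, -1} := by decide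
    rw [this, sum_insert (by decide), sum_insert (by decide), sum_singleton]
  rw [h, if_pos rfl, if_neg (by decide), if_neg (by decide), pow_zero, one_smul, pow_one,
    ← smul_add]
  simp only [SignType.coe_zero, SignType.coe_one, SignType.coe_neg_one, add_zero, ← sub_eq_add_neg]
  rfl

theorem det_updateRow_sum_smul {R ι : Type*} [CommRing R] {n : ℕ} (A : Matrix (Fin n) (Fin n) R)
    (j : Fin n) (s : Finset ι) (c : ι → R) (b : ι → Fin n → R) :
    (A.updateRow j (∑ l ∈ s, c l • b l)).det = ∑ l ∈ s, c l * (A.updateRow j (b l)).det := by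
  have h := Matrix.detRowAlternating.toMultilinearMap.map_update_sum (R := R) s j
    (fun l => c l • b l) A
  refine h.trans (sum_congr rfl fun l _ => ?_)
  exact Matrix.det_updateRow_smul A j (c l) (b l)

theorem det_shiftMatrix_updateRow {K : Type*} [Field K] (n m : ℕ) (j : Fin n) (b : Fin n → K[X]) :
    ((shiftMatrix K n m).updateRow j b).det =
      ∑ s ∈ univ.filter (fun s : Fin n → SignType => s j = 1),
        ((Matrix.of fun i => (X : K[X]) ^ (if s i = 0 then 0 else 1) •
          valueRow K n m (n - i + (s i : ℤ))).updateRow j b).det := by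
  -- Row j is attached to the choice +1 alone, so expanding all rows gives exactly the sign vectors
  -- with s j = 1.
  let g : Fin n → SignType → Fin n → K[X] := fun i a =>
    if i = j then (if a = 1 then b else 0) else
      (X : K[X]) ^ (if a = 0 then 0 else 1) • valueRow K n m (n - i + (a : ℤ))
  have h1 : (shiftMatrix K n m).updateRow j b = fun i => ∑ a, g i a := by
    funext i
    by_cases hi : i = j
    · subst hi
      rw [Matrix.updateRow_self]
      simp only [g, if_true, sum_ite_eq', mem_univ]
    · rw [Matrix.updateRow_ne hi]
      simp only [g, if_neg hi]
      exact shiftMatrix_row n m i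
  have h2 := Matrix.detRowAlternating.toMultilinearMap.map_sum (R := K[X]) g
  rw [h1, sum_filter]
  refine h2.trans (sum_congr rfl fun s _ => ?_)
  split_ifs with hs
  · refine congrArg Matrix.det (funext fun i => ?_)
    by_cases hi : i = j
    · subst hi
      rw [Matrix.updateRow_self]
      simp only [g, if_true, hs]
    · rw [Matrix.updateRow_ne hi]
      simp only [g, if_neg hi]
      rfl
  · exact Matrix.det_eq_zero_of_row_eq_zero j fun k => by simp [g, hs]

theorem prod_X_pow {K : Type*} [Field K] {n : ℕ} (s : Fin n → SignType) :
    ∏ i, (X : K[X]) ^ (if s i = 0 then 0 else 1) = X ^ suppCard s := by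
  rw [prod_pow_eq_pow_sum, suppCard, card_filter]
  simp only [ite_not]

theorem genLam_eq_sum {K : Type*} [Field K] (q t : K) (n m : ℕ) :
    genLam q t n m = ∑ j : Fin n, ∑ s ∈ univ.filter (fun s : Fin n → SignType => s j = 1),
      ∑ l ∈ (range (n - j + 2)).filter (fun l => 2 * l < n - j + 1),
        C (F 1 (n - j) l q t * extend (fun μ => if μ = omega n m then (1 : K) else 0)
          (signWeight s - (l : ℤ) • ((2 : ℤ) • e j))) * X ^ suppCard s := by
  rw [genLam]
  refine sum_congr rfl fun j _ => ?_
  rw [det_shiftMatrix_updateRow]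
  refine sum_congr rfl fun s hs => ?_
  have hs := (mem_filter.1 hs).2
  rw [coeffRow, det_updateRow_sum_smul]
  refine sum_congr rfl fun l hl => ?_
  have hl := (mem_filter.1 hl).2
  have hs1 : ∀ a : SignType, (a : ℤ) ≤ 1 ∧ -1 ≤ (a : ℤ) := by decide
  have hv : ∀ i, (signWeight s - (l : ℤ) • ((2 : ℤ) • e j) + rho n) i =
      if i = j then ((n - j : ℕ) : ℤ) + 1 - 2 * l else n - (i : ℕ) + (s i : ℤ) := by
    intro i
    have := i.2
    simp only [Pi.add_apply, Pi.sub_apply, Pi.smul_apply, e_apply, signWeight, rho, smul_eq_mul]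
    split_ifs with h
    · subst h
      rw [hs, SignType.coe_one]
      omega
    · ring
  -- The power of X is distributed over the rows with nonzero sign; row j takes its X from the
  -- factor built into `coeffRow`.
  rw [C_mul, ← det_valueRow_eq_extend, mul_assoc, mul_comm _ (X ^ suppCard s), ← prod_X_pow,
    ← Matrix.det_mul_column]
  · congr 2
    ext1 i k
    rw [Matrix.of_apply, Matrix.of_apply, hv]
    by_cases hi : i = j
    · subst hi
      rw [Matrix.updateRow_self, if_pos rfl, hs, if_neg (by decide), pow_one, Pi.smul_apply,
        smul_eq_mul]
    · rw [Matrix.updateRow_ne hi, if_neg hi, Matrix.of_apply, Pi.smul_apply, smul_eq_mul]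
  · intro i
    rw [hv]
    have := i.2
    have := hs1 (s i)
    split_ifs <;> omega

theorem Lam_eq_coeff {K : Type*} [Field K] (q t : K) {n r : ℕ} (hr : 1 ≤ r) (hrn : 2 * r ≤ n)
    (h : ℕ) : Lam n r h q t = (genLam q t n (2 * h)).coeff (2 * r) := by
  rw [Lam, sum_pairs_omega hr hrn, genLam_eq_sum, finsetSum_coeff]
  simp only [omega_dot_omega_one (show 1 ≤ 2 * r by omega) (show 1 ≤ n by omega), ht_e]
  refine sum_congr rfl fun j _ => ?_
  rw [finsetSum_coeff, ← filter_filter, sum_filter]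
  refine sum_congr rfl fun s _ => ?_
  simp only [finsetSum_coeff, coeff_C_mul, coeff_X_pow, mul_ite, mul_one, mul_zero]
  split_ifs with h1 h2 h2
  · rfl
  · exact absurd h1.symm h2
  · exact absurd h2.symm h1
  · rw [sum_const_zero]

/-! ### Recurrence for the Λ, and elimination by the A_i. -/

/-- The constant coefficient `Λ_0^{s,m}`, extended by `0` to `s = 0`. -/
noncomputable def constLam {K : Type*} [Field K] (q t : K) (s m : ℕ) : K :=
  (genLam q t m 0).coeff (2 * s)

theorem constLam_zero {K : Type*} [Field K] {q t : K} (hq : q ≠ 0) (ht0 : t ≠ 0) (m : ℕ) :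
    constLam q t 0 m = 0 := by
  rw [constLam, genLam_zero hq ht0, mul_zero, mul_coeff_zero]
  simp

/-- Comparing coefficients in `genLam_zero_add_two` leaves an unknown sum of `primF`; the case s = 0
identifies it as minus Λ_0^{1,m+2}. -/
theorem constLam_succ {K : Type*} [Field K] {q t : K} (hq : q ≠ 0) (ht0 : t ≠ 0) (s m : ℕ) :
    constLam q t (s + 1) (m + 2) = constLam q t s m +
      (-1) ^ s * ((m - s).choose s : K) * constLam q t 1 (m + 2) := by
  have h : ∀ s, constLam q t (s + 1) (m + 2) = constLam q t s m -
      (-1) ^ s * ((m - s).choose s : K) * ∑ x ∈ range (m + 1), primF q t (x + 1) := fun s => by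
    rw [constLam, genLam_zero_add_two hq ht0, coeff_sub, mul_add, mul_one, coeff_X_pow_mul,
      coeff_X_pow_mul, coeff_mul_C, coeff_triDet, constLam]
  have h0 := h 0
  rw [constLam_zero hq ht0] at h0
  rw [h s, h0]
  simp
  ring

theorem Lam_add {K : Type*} [Field K] (q t : K) {m h s : ℕ} (hr : 1 ≤ s + h) (hs : 2 * s ≤ m) :
    Lam (m + 2 * h) (s + h) h q t = constLam q t s m +
      (∑ a ∈ range (2 * h), leadF q t (m + a + 1)) * ((-1) ^ s * ((m - s).choose s : K)) := by
  rw [Lam_eq_coeff q t hr (by omega), genLam_add, mul_add 2, coeff_X_pow_mul, coeff_add,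
    coeff_C_mul, det_shiftMatrix_zero, coeff_triDet, constLam]

theorem Lam_zero {K : Type*} [Field K] (q t : K) {m s : ℕ} (hr : 1 ≤ s) (hs : 2 * s ≤ m) :
    Lam m s 0 q t = constLam q t s m := by
  have h := Lam_add q t (h := 0) hr hs
  simpa using h

theorem A_self (k n : ℕ) : A (k + 1) n (k + 1) = 1 := by
  simp [A]

theorem A_succ (k n h : ℕ) (h1 : 1 ≤ h) (hk : h ≤ k) : A (k + 1) n (h + 1) = A k (n - 2) h := by
  rcases hk.eq_or_lt with rfl | hk
  · obtain ⟨h, rfl⟩ : ∃ h', h = h' + 1 := ⟨h - 1, by omega⟩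
    rw [A_self, A_self]
  · rw [A, if_neg (by omega), if_neg (by omega), if_pos (by omega), Nat.add_sub_cancel]

theorem sum_Icc_shift {M : Type*} [AddCommMonoid M] (a b : ℕ) (g : ℕ → M) :
    ∑ i ∈ Icc (a + 1) (b + 1), g i = ∑ i ∈ Icc a b, g (i + 1) := by
  refine sum_nbij' (fun i => i - 1) (fun i => i + 1) ?_ ?_ ?_ ?_ ?_ <;> intro i hi <;>
    simp only [mem_Icc] at * <;> first | omega | skip
  rw [Nat.sub_add_cancel (by omega)]

theorem sum_Icc_one_succ {M : Type*} [AddCommMonoid M] (k : ℕ) (g : ℕ → M) :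
    ∑ i ∈ Icc 1 (k + 1), g i = g 1 + ∑ i ∈ Icc 1 k, g (i + 1) := by
  rw [← sum_Icc_shift, ← insert_Icc_add_one_left_eq_Icc (show 1 ≤ k + 1 by omega), sum_insert]
  simp

/-- In this form A_1 is visibly the value making the alternating binomial sum for h = 1 vanish. -/
theorem A_one (k n : ℕ) (hk : 1 ≤ k) : A (k + 1) n 1 =
    -∑ i ∈ Icc 1 k, A k (n - 2) i * ((-1) ^ i * ((n - 2 - i).choose i : ℤ)) := by
  rw [A, if_neg (by omega), if_neg (by omega), if_neg (by omega), sum_Icc_shift, ← sum_neg_distrib]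
  refine sum_congr rfl fun i _ => ?_
  rw [Nat.add_sub_cancel, show n - (i + 1) - 1 = n - 2 - i by omega]
  ring

/-- The coefficients `A_i` annihilate the triangular arrays of signed binomial coefficients. -/
theorem sum_A_mul_choose (k n h : ℕ) (hk : h + 1 < k) :
    ∑ i ∈ Icc (h + 1) k, A k n i *
      ((-1) ^ (i - (h + 1)) * ((n - 2 * (h + 1) - (i - (h + 1))).choose (i - (h + 1)) : ℤ)) = 0 := by
  induction h generalizing k n with
  | zero =>
    obtain ⟨k, rfl⟩ : ∃ k', k = k' + 1 := ⟨k - 1, by omega⟩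
    rw [zero_add, sum_Icc_one_succ, A_one k n (by omega)]
    have h : ∀ i ∈ Icc 1 k, A (k + 1) n (i + 1) * ((-1) ^ (i + 1 - 1) *
        ((n - 2 * 1 - (i + 1 - 1)).choose (i + 1 - 1) : ℤ)) =
        A k (n - 2) i * ((-1) ^ i * ((n - 2 - i).choose i : ℤ)) := fun i hi => by
      rw [mem_Icc] at hi
      rw [A_succ k n i hi.1 hi.2, Nat.add_sub_cancel]
    rw [sum_congr rfl h]
    simp
  | succ h ih =>
    obtain ⟨k, rfl⟩ : ∃ k', k = k' + 1 := ⟨k - 1, by omega⟩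
    rw [sum_Icc_shift, ← ih k (n - 2) (by omega)]
    refine sum_congr rfl fun i hi => ?_
    rw [mem_Icc] at hi
    rw [A_succ k n i (by omega) hi.2, Nat.add_sub_add_right,
      show n - 2 * (h + 1 + 1) = n - 2 - 2 * (h + 1) by omega]

/-- Induction lowering k by 1 and n by 2: the binomial terms of `constLam_succ` cancel against A_1.
-/
theorem sum_A_mul_constLam {K : Type*} [Field K] {q t : K} (hq : q ≠ 0) (ht0 : t ≠ 0) (k n : ℕ)
    (hk : 1 ≤ k) (hkn : 2 * k ≤ n) :
    ∑ i ∈ Icc 1 k, (A k n i : K) * constLam q t i n = constLam q t 1 (n - 2 * k + 2) := by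
  induction k, hk using Nat.le_induction generalizing n with
  | base =>
    rw [Icc_self, sum_singleton, A_self, Int.cast_one, one_mul, mul_one, Nat.sub_add_cancel hkn]
  | succ k hk ih =>
    obtain ⟨m, rfl⟩ : ∃ m, n = m + 2 := ⟨n - 2, by omega⟩
    have h : ∀ i ∈ Icc 1 k, (A (k + 1) (m + 2) (i + 1) : K) * constLam q t (i + 1) (m + 2) =
        (A k m i : K) * constLam q t i m +
          ((A k m i * ((-1) ^ i * ((m - i).choose i : ℤ)) : ℤ) : K) * constLam q t 1 (m + 2) := by
      intro i hi
      rw [mem_Icc] at hi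
      rw [A_succ k _ i hi.1 hi.2, constLam_succ hq ht0, Nat.add_sub_cancel]
      push_cast
      ring
    rw [sum_Icc_one_succ, sum_congr rfl h, sum_add_distrib, ih m (by omega), ← sum_mul,
      A_one k _ hk, show m + 2 - 2 * (k + 1) + 2 = m - 2 * k + 2 by omega, Nat.add_sub_cancel]
    push_cast
    ring

/-- The term i = h + 1 vanishes by `constLam_zero`, and `A_succ` shifts the rest down to
`sum_A_mul_constLam`. -/
theorem sum_A_mul_constLam_sub {K : Type*} [Field K] {q t : K} (hq : q ≠ 0) (ht0 : t ≠ 0)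
    (k n h : ℕ) (hk : h + 1 < k) (hkn : 2 * k ≤ n) :
    ∑ i ∈ Icc (h + 1) k, (A k n i : K) * constLam q t (i - (h + 1)) (n - 2 * (h + 1)) =
      constLam q t 1 (n - 2 * k + 2) := by
  obtain ⟨k, rfl⟩ : ∃ k', k = k' + 1 := ⟨k - 1, by omega⟩
  rw [show n - 2 * (k + 1) + 2 = n - 2 - 2 * k + 2 by omega]
  induction h generalizing k n with
  | zero =>
    rw [zero_add, sum_Icc_one_succ, Nat.sub_self, constLam_zero hq ht0, mul_zero, zero_add,
      ← sum_A_mul_constLam hq ht0 k (n - 2) (by omega) (by omega)]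
    refine sum_congr rfl fun i hi => ?_
    rw [mem_Icc] at hi
    rw [A_succ k n i hi.1 hi.2, Nat.add_sub_cancel]
  | succ h ih =>
    obtain ⟨k, rfl⟩ : ∃ k', k = k' + 1 := ⟨k - 1, by omega⟩
    rw [sum_Icc_shift, show n - 2 - 2 * (k + 1) + 2 = n - 2 - 2 - 2 * k + 2 by omega,
      ← ih (n - 2) k (by omega) (by omega)]
    refine sum_congr rfl fun i hi => ?_
    rw [mem_Icc] at hi
    rw [A_succ _ n i (by omega) hi.2, Nat.add_sub_add_right,
      show n - 2 * (h + 1 + 1) = n - 2 - 2 * (h + 1) by omega]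

theorem sum_A_mul_Lam {K : Type*} [Field K] {q t : K} (hq : q ≠ 0) (ht0 : t ≠ 0) (k n h : ℕ)
    (hk : h < k) (hkn : 2 * k ≤ n) :
    ∑ i ∈ Icc (max 1 h) k, (A k n i : K) * Lam n i h q t = Lam (n - 2 * k + 2) 1 0 q t := by
  rw [Lam_zero q t le_rfl (by omega)]
  rcases h with _ | h
  · rw [max_eq_left (Nat.zero_le 1), ← sum_A_mul_constLam hq ht0 k n (by omega) hkn]
    refine sum_congr rfl fun i hi => ?_
    rw [mem_Icc] at hi
    rw [Lam_zero q t hi.1 (by omega)]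
  · have hL : ∀ i ∈ Icc (h + 1) k, (A k n i : K) * Lam n i (h + 1) q t =
        (A k n i : K) * constLam q t (i - (h + 1)) (n - 2 * (h + 1)) +
          (∑ a ∈ range (2 * (h + 1)), leadF q t (n - 2 * (h + 1) + a + 1)) *
            ((A k n i * ((-1) ^ (i - (h + 1)) *
              ((n - 2 * (h + 1) - (i - (h + 1))).choose (i - (h + 1)) : ℤ)) : ℤ) : K) := by
      intro i hi
      rw [mem_Icc] at hi
      have := Lam_add q t (m := n - 2 * (h + 1)) (h := h + 1) (s := i - (h + 1)) (by omega) (by omega)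
      rw [Nat.sub_add_cancel (by omega), Nat.sub_add_cancel hi.1] at this
      rw [this]
      push_cast
      ring
    rw [max_eq_right (by omega), sum_congr rfl hL, sum_add_distrib,
      sum_A_mul_constLam_sub hq ht0 k n h hk hkn, ← mul_sum, ← Int.cast_sum,
      sum_A_mul_choose k n h hk, Int.cast_zero, mul_zero, add_zero]

theorem sum_A_smul_R {K M : Type*} [Field K] [AddCommGroup M] [Module K M] {q t : K}
    (hq : q ≠ 0) (ht0 : t ≠ 0) (n k : ℕ) (hk : 1 ≤ k) (hkn : 2 * k ≤ n) (C : Weight n → M) :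
    ∑ i ∈ Icc 1 k, A k n i • R n i q t C =
      Lam n k k q t • C (omega n (2 * k)) +
        Lam (n - 2 * k + 2) 1 0 q t • ∑ h ∈ range k, C (omega n (2 * h)) := by
  have h1 : ∑ i ∈ Icc 1 k, A k n i • R n i q t C = ∑ h ∈ range (k + 1),
      ∑ i ∈ Icc (max 1 h) k, ((A k n i : K) * Lam n i h q t) • C (omega n (2 * h)) := by
    simp only [R, smul_sum, mul_smul, Int.cast_smul_eq_zsmul]
    -- The conditions 1 ≤ i and h ≤ i merge into max 1 h ≤ i.
    refine sum_comm' fun i h => ?_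
    simp only [mem_Icc, mem_range]
    omega
  rw [h1, sum_range_succ, max_eq_right hk, Icc_self, sum_singleton, add_comm, smul_sum]
  congr 1
  · obtain ⟨k, rfl⟩ : ∃ k', k = k' + 1 := ⟨k - 1, by omega⟩
    rw [A_self, Int.cast_one, one_mul]
  · refine sum_congr rfl fun h hh => ?_
    rw [← sum_smul, sum_A_mul_Lam hq ht0 k n h (mem_range.1 hh) hkn]

end TypeC

theorem mainTheorem7 {K : Type*} [Field K] [CharZero K] (q t : K) (hq : q ≠ 0) (ht : t ≠ 0)
    {M : Type*} [AddCommGroup M] [Module K M] (n k : ℕ) (hk : 1 ≤ k) (hkn : 2 * k ≤ n)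
    (C : TypeC.Weight n → M) :
    (∀ i, 1 ≤ i → i ≤ k →
      TypeC.qmRecurrence (TypeC.omega n (2 * i)) q t C = (2 : K) • TypeC.R n i q t C) ∧
    ∑ i ∈ Finset.Icc 1 k, TypeC.A k n i • TypeC.R n i q t C =
      TypeC.Lam n k k q t • C (TypeC.omega n (2 * k)) +
        TypeC.Lam (n - 2 * k + 2) 1 0 q t •
          ∑ h ∈ Finset.range k, C (TypeC.omega n (2 * h)) ∧
    ((∀ i, 1 ≤ i → i ≤ k → TypeC.qmRecurrence (TypeC.omega n (2 * i)) q t C = 0) →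
      TypeC.Lam n k k q t • C (TypeC.omega n (2 * k)) +
        TypeC.Lam (n - 2 * k + 2) 1 0 q t •
          ∑ h ∈ Finset.range k, C (TypeC.omega n (2 * h)) = 0) := by
  have h1 : ∀ i, 1 ≤ i → i ≤ k →
      TypeC.qmRecurrence (TypeC.omega n (2 * i)) q t C = (2 : K) • TypeC.R n i q t C :=
    fun i hi hik => TypeC.qmRecurrence_omega hq ht hi (by omega) C
  have h2 := TypeC.sum_A_smul_R hq ht n k hk hkn C
  refine ⟨h1, h2, fun h => ?_⟩
  rw [← h2]
  refine Finset.sum_eq_zero fun i hi => ?_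
  rw [Finset.mem_Icc] at hi
  have h3 := h i hi.1 hi.2
  rw [h1 i hi.1 hi.2] at h3
  -- Characteristic zero is what permits cancelling the factor 2.
  rw [(smul_eq_zero.1 h3).resolve_left two_ne_zero, smul_zero]
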